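/- **Setting.** Let $\Lambda=\{1,\dots,n\}$, $n\ge 1$, be a chain of qudits of dimension $d$, and let $H=\sum_{\emptyset\ne Z\subseteq\Lambda}h_Z$ with $h_Z$ Hermitian and supported on $Z$, and $\max_i\sum_{Z\ni i}\|h_Z\|\le g$. For $1\le s\le n-1$ put $A_s=\{1,\dots,s\}$, $B_s=\Lambda\setminus A_s$, and let $V_s$ be the sum of those $h_Z$ for which $Z$ meets both $A_s$ and $B_s$. For an operator $\Phi$, the spectral entangling strength $\bar{\mathcal J}_s(\Phi)$ is the supremum, over normalized product vectors $\phi_{A_sA'}\otimes\phi_{B_sB'}$ with arbitrary finite-dimensional ancillas $A',B'$, of the sum of the Schmidt coefficients of $\Phi(\phi_{A_sA'}\otimes\phi_{B_sB'})$ across $A_sA'|B_sB'$. Let $\tilde J\ge 0$ satisfy $\bar{\mathcal J}_s(V_s)\le\tilde J$ for all $s$. **Algorithm.** Let $\psi_0$ be a normalized product state, $t\ge 0$, and let $N,D\ge1$ be integers, $\Delta t=t/N$. Put $M_0=\psi_0$. Given $M_m$, take Schmidt decompositions of $(1-iH\Delta t)M_m$ at all cuts $A_s|B_s$, with coefficients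 $\lambda^{(s)}_{m,1}\ge\lambda^{(s)}_{m,2}\ge\cdots$, and let $T_m$ be the truncation of $(1-iH\Delta t)M_m$ in the corresponding canonical form to the first $D$ values of each bond index. Equivalently, $T_m=Q_{n-1}\cdots Q_1(1-iH\Delta t)M_m$, where $Q_s$ acts on $B_s$ as the orthogonal projection onto the span of the first $D$ right Schmidt vectors at cut $s$. Either $M_{m+1}=T_m$ (plain version), or $M_{m+1}=T_m/\max(1,\|T_m\|)$ (rescaled version, for which $\|M_m\|\le1$ always). Let $$\bar\delta_m(D)=\max_{1\le s\le n-1}\Big(\sum_{j>D}(\lambda^{(s)}_{m,j})^2\Big)^{1/2}$$ (zero if $n=1$). **Theorem.** Both versions of the algorithm can be carried out. Assume $gnt/N\le1$. For every choice of the Schmidt decompositions in either version: 1. Every $M_m$ is a matrix product state of bond dimension $D$, and at every cut the sum of the Schmidt coefficients of $M_{m+1}$ is at most that of $(1-iH\Delta t)M_m$. For $0\le m\le N-1$ and every $s$, $\sum_j\lambda^{(s)}_{m,j}\le e^{\tilde Jt+(gnt)^2/N}$. (For a normalized state, the sum of the Schmidt coefficients is $e^{E_{1/2}/2}$ with $E_{1/2}$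 the Rényi-$\frac12$ entanglement entropy.) 2. For $0\le m\le N-1$, $$\bar\delta_m(D)\le \frac{e^{\tilde Jt+(gnt)^2/N}}{\sqrt D}.$$ 3. In the rescaled version, and in the plain version if $(gnt)^2/N\le2$, $$\big\|e^{-iHt}\psi_0-M_N\big\|\le\frac{(gnt)^2}{N}+N\sqrt{\frac{2n}{D}}\;e^{\tilde Jt+(gnt)^2/N}.$$ 4. Polynomial $N$ and $D$ suffice: for every $0<\epsilon\le1$ there are $N\le 2(gnt)^2/\epsilon+1$ with $gnt\le N$, and $D\le100\,e^{2\tilde Jt}\,n\,(1+(gnt)^2)^2/\epsilon^4$, such that $\|e^{-iHt}\psi_0-M_N\|\le\epsilon$ for every run of either version. 5. Let the interactions decay as $\sum_{Z\ni i,i'}\|h_Z\|\le J_0|i-i'|^{-\eta}$ for all $i\ne i'$, with $\eta>2$. If $h_Z=0$ whenever $|Z|>k$, then $\tilde J=d^{\lfloor k/2\rfloor}\,\eta J_0/(\eta-2)$ is admissible. If every $h_Z$ is a tensor product of single-site operators, then $\tilde J=\eta J_0/(\eta-2)$ is admissible. -/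

import Mathlib

open scoped BigOperators ENNReal NNReal

noncomputable section

namespace TDMRG

/-- Basis configurations of a chain of `n` sites (numbered from `0`) of local dimension `d`. -/
abbrev Cfg (n d : ℕ) : Type := Fin n → Fin d

/-- Configurations of the first `s` sites. -/
abbrev LCfg (n d s : ℕ) : Type := {i : Fin n // i.val < s} → Fin d

/-- Configurations of the remaining sites. -/
abbrev RCfg (n d s : ℕ) : Type := {i : Fin n // ¬ i.val < s} → Fin d

/-- The Hilbert space of the chain, with its computational basis. -/
abbrev Chain (n d : ℕ) : Type := EuclideanSpace ℂ (Cfg n d)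

abbrev Op (n d : ℕ) : Type := Chain n d →L[ℂ] Chain n d

variable {n d : ℕ}

def lpart (s : ℕ) (x : Cfg n d) : LCfg n d s := fun i => x i.1

def rpart (s : ℕ) (x : Cfg n d) : RCfg n d s := fun i => x i.1

def glue (s : ℕ) (a : LCfg n d s) (b : RCfg n d s) : Cfg n d :=
  fun i => if h : i.val < s then a ⟨i, h⟩ else b ⟨i, h⟩

/-! ### Schmidt decompositions -/

/-- A Schmidt decomposition `∑ j, coeff j • (left j ⊗ right j)` of the bipartite (not necessarily
normalized) vector with amplitudes `C`; only the nonzero coefficients are listed, in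
non-increasing order. -/
structure SchmidtDecomposition {α β : Type} [Fintype α] [Fintype β] (C : α → β → ℂ) where
  rank : ℕ
  coeff : Fin rank → ℝ
  coeff_pos : ∀ j, 0 < coeff j
  coeff_antitone : Antitone coeff
  left : Fin rank → EuclideanSpace ℂ α
  right : Fin rank → EuclideanSpace ℂ β
  left_orthonormal : Orthonormal ℂ left
  right_orthonormal : Orthonormal ℂ right
  expand : ∀ x y, C x y = ∑ j, (coeff j : ℂ) * left j x * right j y

namespace SchmidtDecomposition

variable {α β : Type} [Fintype α] [Fintype β] {C : α → β → ℂ}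

/-- The sum of the Schmidt coefficients; for a normalized vector this is `exp (E / 2)` with `E` the
Rényi entanglement entropy of order `1/2`. -/
def sum (S : SchmidtDecomposition C) : ℝ := ∑ j, S.coeff j

/-- The truncation error: the square root of the sum of the squares of all Schmidt coefficients
but the `D` largest ones. -/
def tail (S : SchmidtDecomposition C) (D : ℕ) : ℝ :=
  Real.sqrt (∑ j ∈ Finset.univ.filter (fun j : Fin S.rank => D ≤ j.val), S.coeff j ^ 2)

end SchmidtDecomposition

/-- The amplitudes of `ψ` as a bipartite vector for the cut after the first `s` sites. -/
def cutAmp (s : ℕ) (ψ : Chain n d) : LCfg n d s → RCfg n d s → ℂ :=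
  fun a b => ψ (glue s a b)

/-! ### Spectral entangling strength -/

/-- The amplitudes of `(O ⊗ 1) (φ ⊗ χ)`, where `φ` lives on the first `s` sites and an ancilla of
dimension `p`, and `χ` on the remaining sites and an ancilla of dimension `q`. -/
def ancillaAmp (s : ℕ) (O : Op n d) {p q : ℕ}
    (φ : EuclideanSpace ℂ (LCfg n d s × Fin p)) (χ : EuclideanSpace ℂ (RCfg n d s × Fin q)) :
    LCfg n d s × Fin p → RCfg n d s × Fin q → ℂ :=
  fun a b => O (WithLp.toLp 2 fun z => φ (lpart s z, a.2) * χ (rpart s z, b.2)) (glue s a.1 b.1)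

/-- The spectral entangling strength of `O` for the cut after the first `s` sites: the supremum of
the sum of the Schmidt coefficients of `O (φ ⊗ χ)` over normalized product vectors `φ ⊗ χ`,
ancillas allowed. -/
def seStrength (s : ℕ) (O : Op n d) : ℝ≥0∞ :=
  ⨆ (p : ℕ) (q : ℕ) (φ : EuclideanSpace ℂ (LCfg n d s × Fin p))
    (χ : EuclideanSpace ℂ (RCfg n d s × Fin q)) (_ : ‖φ‖ = 1) (_ : ‖χ‖ = 1)
    (S : SchmidtDecomposition (ancillaAmp s O φ χ)), ENNReal.ofReal S.sum

/-! ### Hamiltonians -/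

/-- `O` acts only on the sites in `Z`, that is `O = K ⊗ 1` with `K` acting on these sites. -/
def SupportedOn (Z : Finset (Fin n)) (O : Op n d) : Prop :=
  ∃ K : ({i // i ∈ Z} → Fin d) → ({i // i ∈ Z} → Fin d) → ℂ, ∀ (ψ : Chain n d) (x : Cfg n d),
    O ψ x = ∑ z : {i // i ∈ Z} → Fin d,
      K (fun i => x i.1) z * ψ (fun i => if h : i ∈ Z then z ⟨i, h⟩ else x i)

/-- A Hamiltonian on the chain, given by Hermitian interaction terms supported on nonempty sets. -/
structure Interaction (n d : ℕ) where
  term : Finset (Fin n) → Op n d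
  term_selfAdjoint : ∀ Z, IsSelfAdjoint (term Z)
  term_supported : ∀ Z, SupportedOn Z (term Z)
  term_empty : term ∅ = 0

namespace Interaction

/-- The total Hamiltonian. -/
def ham (H : Interaction n d) : Op n d := ∑ Z, H.term Z

/-- The boundary interaction for the cut after the first `s` sites. -/
def boundary (H : Interaction n d) (s : ℕ) : Op n d :=
  ∑ Z ∈ Finset.univ.filter
    (fun Z : Finset (Fin n) => (∃ i ∈ Z, i.val < s) ∧ (∃ i ∈ Z, ¬ i.val < s)), H.term Z

/-- The one-site energy is at most `g`. -/
def OneSiteEnergyLE (H : Interaction n d) (g : ℝ) : Prop :=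
  ∀ i : Fin n, ∑ Z ∈ Finset.univ.filter (fun Z : Finset (Fin n) => i ∈ Z), ‖H.term Z‖ ≤ g

def IsKLocal (H : Interaction n d) (k : ℕ) : Prop :=
  ∀ Z : Finset (Fin n), k < Z.card → H.term Z = 0

/-- Interaction decay with `J(r) = J₀ r ^ (-η)`. -/
def PowerLawDecay (H : Interaction n d) (J₀ η : ℝ) : Prop :=
  ∀ i j : Fin n, i ≠ j →
    ∑ Z ∈ Finset.univ.filter (fun Z : Finset (Fin n) => i ∈ Z ∧ j ∈ Z), ‖H.term Z‖
      ≤ J₀ * |(i.val : ℝ) - (j.val : ℝ)| ^ (-η)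

end Interaction

/-- `O` is a tensor product of single-site operators. -/
def IsProductOp (O : Op n d) : Prop :=
  ∃ u : Fin n → Matrix (Fin d) (Fin d) ℂ, ∀ (ψ : Chain n d) (x : Cfg n d),
    O ψ x = ∑ y : Cfg n d, (∏ i, u i (x i) (y i)) * ψ y

/-- The exact evolution `exp (-i H t) ψ`. -/
def evolve (H : Interaction n d) (t : ℝ) (ψ : Chain n d) : Chain n d :=
  NormedSpace.exp ((-(Complex.I * (t : ℂ))) • H.ham) ψ

/-- The first-order step `(1 - i H τ) ψ`. -/
def eulerStep (H : Interaction n d) (τ : ℝ) (ψ : Chain n d) : Chain n d :=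
  ψ - (Complex.I * (τ : ℂ)) • H.ham ψ

/-! ### States, matrix product states, truncation -/

/-- A normalized vector that is a tensor product of single-site vectors. -/
def IsProductState (ψ : Chain n d) : Prop :=
  ∃ u : Fin n → EuclideanSpace ℂ (Fin d), (∀ i, ‖u i‖ = 1) ∧ ∀ x, ψ x = ∏ i, u i (x i)

/-- `ψ` is a matrix product state of bond dimension `D`. -/
def IsMPS (D : ℕ) (ψ : Chain n d) : Prop :=
  ∃ M : Fin n → Fin d → Matrix (Fin D) (Fin D) ℂ, ∀ x : Cfg n d,
    ψ x = Matrix.trace (List.ofFn fun i => M i (x i)).prod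

/-- The orthogonal projection, acting on the sites right of the cut, onto the span of the right
Schmidt vectors of `S` with the `D` largest coefficients, applied to `φ`. -/
def projRight (s D : ℕ) {C : LCfg n d s → RCfg n d s → ℂ} (S : SchmidtDecomposition C)
    (φ : Chain n d) : Chain n d :=
  WithLp.toLp 2 fun x =>
    ∑ j ∈ Finset.univ.filter (fun j : Fin S.rank => j.val < D),
      (∑ y : RCfg n d s, star (S.right j y) * φ (glue s (lpart s x) y)) * S.right j (rpart s x)

/-- Schmidt decompositions of `ψ` at all the cuts of the chain, that is, a canonical form of `ψ`;
`c : Fin (n - 1)` labels the cut after the first `c + 1` sites. -/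
abbrev CanonicalForm (ψ : Chain n d) : Type :=
  (c : Fin (n - 1)) → SchmidtDecomposition (cutAmp (c.val + 1) ψ)

/-- The truncation of `ψ` to bond dimension `D` in canonical form. The canonical tensor at the site
between two neighbouring cuts expresses the right Schmidt vectors of the left cut through those of
the right cut; keeping only the first `D` values of every bond index of these tensors inserts, at
each cut, the projection onto the first `D` right Schmidt vectors of `ψ`, the leftmost cut first. -/
def truncate (D : ℕ) {ψ : Chain n d} (F : CanonicalForm ψ) : Chain n d :=
  (List.finRange (n - 1)).foldl (fun φ c => projRight (c.val + 1) D (F c) φ) ψ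

/-- Rescaling of the vectors of norm larger than one to norm one. -/
def clip (φ : Chain n d) : Chain n d := ((max 1 ‖φ‖)⁻¹ : ℝ) • φ

/-- A run of first-order t-DMRG with time step `t / N` and bond dimension `D` from `ψ₀`;
`state m` is the state after `m` steps, so `state N` is the output (the recursion is continued
after step `N` only for convenience). With `rescale = true`, truncated states of norm larger than
one are rescaled to norm one. The Schmidt decompositions that are used are part of the run, since
they need not be unique. -/
structure Run (H : Interaction n d) (t : ℝ) (N D : ℕ) (rescale : Bool) (ψ₀ : Chain n d) where
  state : ℕ → Chain n d
  form : ∀ m, CanonicalForm (eulerStep H (t / N) (state m))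
  state_zero : state 0 = ψ₀
  state_succ : ∀ m, state (m + 1) =
    if rescale then clip (truncate D (form m)) else truncate D (form m)

namespace Run

variable {H : Interaction n d} {t : ℝ} {N D : ℕ} {rescale : Bool} {ψ₀ : Chain n d}

/-- The largest truncation error over all cuts in step `m`, i.e. for `(1 - i H t / N)` applied to
the state after `m` steps (zero if the chain has no cut). -/
def truncError (R : Run H t N D rescale ψ₀) (m : ℕ) : ℝ :=
  ⨆ c : Fin (n - 1), (R.form m c).tail D

end Run

end TDMRG

end

/-! The sum of the Schmidt coefficients at a cut is the projective tensor norm: the least value of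
`∑ ‖a k‖ * ‖b k‖` over all expansions `∑ a k ⊗ b k` (`SchmidtDecomposition.sum_le`). So it is
subadditive, an operator `O ⊗ O'` multiplies it by at most `‖O‖ * ‖O'‖` (`cutNorm_local_le`), and an
operator of spectral entangling strength `J` by at most `J`.

Growth in one step. With `A`, `B` the parts of `H` on the two sides of the cut, `V` the boundary
part and `z = iτ`, one has `1 - zH = (1 - zA)(1 - zB) + τ²AB - zV`. As `A` is self-adjoint, `‖1 -
zA‖² ≤ 1 + τ²‖A‖²`, without a term linear in `τ`. The only first-order growth comes from `V`, and
the factor is at most `1 + Jτ + (gnτ)²/2` (`cutNorm_eulerStep_le`).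

Truncation does not increase the sum at any cut `c` (`cutNorm_truncate_le`). Projections at cuts
beyond `c` act right of `c` and are contractions. Those at or before `c` would act across it, but on
the vector being truncated a projection onto right Schmidt vectors equals the one onto the matching
left Schmidt vectors. Since the leftmost cut comes first, the product up to any such cut becomes a
contraction acting left of it. Hence the sum stays below `exp (Jt + (gnt)²/(2N))` for all `N` steps.

Error. Monotonicity of the coefficients gives a tail of at most sum/`√D`. Errors of successive cuts
add in squares (`norm_sub_projRight_sq_le`), so one truncation costs at most `√n` times the largest
tail. The exact evolution is unitary, so Euler errors `(gnτ)²/2 * ‖M_m‖` and truncation errors add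
up over the steps.

Admissible `J`. A term acting on a product vector yields a vector of norm at most the operator norm.
Its Schmidt rank is at most `d^(2m)`, with `m` the number of its sites on either side, and is at
most one for a product operator; Cauchy–Schwarz bounds the sum by `√rank` times the norm. The norms
of the boundary terms are summed over pairs of sites, at most `r` of which straddle the cut at
distance `r`. -/

namespace TDMRG

/-! ### Schmidt decompositions: existence, minimality, tails and rank. -/

namespace SchmidtDecomposition

variable {α β : Type} [Fintype α] [Fintype β] {C : α → β → ℂ}

/-- Every bipartite vector has a Schmidt decomposition. -/
theorem exists_schmidtDecomposition (C : α → β → ℂ) : Nonempty (SchmidtDecomposition C) := by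
  classical
  let T : EuclideanSpace ℂ β →ₗ[ℂ] EuclideanSpace ℂ α := Matrix.toEuclideanLin (Matrix.of C)
  have hsym := T.isSymmetric_adjoint_comp_self
  let r := Module.finrank ℂ T.range
  have hr : r ≤ Module.finrank ℂ (EuclideanSpace ℂ β) := LinearMap.finrank_range_le T
  -- In an eigenbasis of `T* T` the images `T (v k)` are orthogonal with norms the singular values,
  -- and they vanish beyond the rank.
  let v := hsym.eigenvectorBasis rfl
  have hinner : ∀ j k, inner ℂ (T (v j)) (T (v k)) =
      if j = k then ((T.singularValues k : ℝ) : ℂ) ^ 2 else 0 := by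
    intro j k
    rw [← LinearMap.adjoint_inner_right, ← LinearMap.comp_apply,
      hsym.apply_eigenvectorBasis rfl k, ← T.sq_singularValues_fin rfl k, inner_smul_right,
      (orthonormal_iff_ite.1 v.orthonormal)]
    split_ifs with h <;> simp
  have hpos : ∀ j : Fin r, 0 < T.singularValues j := fun j =>
    T.singularValues_pos_iff_lt_finrank_range.2 j.2
  let ι : Fin r → Fin (Module.finrank ℂ (EuclideanSpace ℂ β)) := Fin.castLE hr
  have hzero : ∀ k, k ∉ Set.range ι → T (v k) = 0 := by
    intro k hk
    have hk' : ¬ (k : ℕ) < r := fun h => hk ⟨⟨k, h⟩, rfl⟩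
    have h0 : T.singularValues k = 0 := by
      by_contra h
      exact hk' (T.singularValues_pos_iff_lt_finrank_range.1
        ((T.singularValues_pos_iff_ne_zero k).2 h))
    have := hinner k k
    rw [if_pos rfl, h0] at this
    simpa using this
  -- The right vectors are conjugated because column `y` of `C` is `T` applied to a basis vector,
  -- whose coefficients in `v` are `star (v k y)`.
  refine ⟨⟨r, fun j => T.singularValues j, hpos, fun i j h => T.singularValues_antitone h,
    fun j => ((T.singularValues j : ℝ) : ℂ)⁻¹ • T (v (ι j)),
    fun j => WithLp.toLp 2 fun y => star (v (ι j) y), ?_, ?_, ?_⟩⟩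
  · rw [orthonormal_iff_ite]
    intro i j
    have hi : ((T.singularValues i : ℝ) : ℂ) ≠ 0 := by exact_mod_cast (hpos i).ne'
    have hij : ι i = ι j ↔ i = j := (Fin.castLE_injective hr).eq_iff
    rw [inner_smul_left, inner_smul_right, hinner, map_inv₀, Complex.conj_ofReal]
    by_cases h : i = j
    · subst h
      rw [if_pos rfl, if_pos rfl, show ((ι i : Fin _) : ℕ) = i from rfl]
      field_simp
    · simp [h, hij]
  · rw [orthonormal_iff_ite]
    intro i j
    have hij : ι i = ι j ↔ i = j := (Fin.castLE_injective hr).eq_iff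
    have := (orthonormal_iff_ite.1 v.orthonormal) (ι j) (ι i)
    rw [← if_congr (hij.symm.trans eq_comm) rfl rfl] at this
    rw [← this]
    simp [PiLp.inner_apply, mul_comm]
  · intro x y
    have h1 : C x y = T (EuclideanSpace.single y 1) x := by
      simp [T, Matrix.toLpLin_apply]
    have h2 : EuclideanSpace.single y (1 : ℂ) = ∑ k, star (v k y) • v k := by
      conv_lhs => rw [← v.sum_repr' (EuclideanSpace.single y (1 : ℂ))]
      refine Finset.sum_congr rfl fun k _ => ?_
      rw [EuclideanSpace.inner_single_right]
      simp
    have h3 : C x y = ∑ k, star (v k y) * T (v k) x := by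
      rw [h1, h2, map_sum]
      simp
    rw [h3, ← Finset.sum_subset (Finset.subset_univ (Finset.univ.map (Fin.castLEEmb hr)))]
    · rw [Finset.sum_map]
      refine Finset.sum_congr rfl fun j _ => ?_
      have hj : ((T.singularValues j : ℝ) : ℂ) ≠ 0 := by exact_mod_cast (hpos j).ne'
      simp only [PiLp.smul_apply, smul_eq_mul, ι, Fin.castLEEmb_apply]
      field_simp
    · intro k _ hk
      rw [hzero k]
      · simp
      · rintro ⟨j, rfl⟩
        exact hk (Finset.mem_map.2 ⟨j, Finset.mem_univ _, rfl⟩)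

theorem sum_nonneg (S : SchmidtDecomposition C) : 0 ≤ S.sum :=
  Finset.sum_nonneg fun j _ => (S.coeff_pos j).le

/-- The sum of the Schmidt coefficients is a lower bound for `∑ ‖a k‖ * ‖b k‖` over all expansions
`∑ a k ⊗ b k`. -/
theorem sum_le {ι : Type*} [Fintype ι] (S : SchmidtDecomposition C)
    (a : ι → EuclideanSpace ℂ α) (b : ι → EuclideanSpace ℂ β)
    (h : ∀ x y, C x y = ∑ k, a k x * b k y) : S.sum ≤ ∑ k, ‖a k‖ * ‖b k‖ := by
  classical
  -- Pairing both expansions of `C` with `left j ⊗ right j` isolates one coefficient; after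
  -- summation over `j`, Cauchy–Schwarz and Bessel finish.
  have key : ∀ j, (S.coeff j : ℂ) = ∑ k, inner ℂ (S.left j) (a k) * inner ℂ (S.right j) (b k) := by
    intro j
    have h1 : ∑ x, ∑ y, star (S.left j x) * star (S.right j y) * C x y = S.coeff j := by
      have : ∀ x y, star (S.left j x) * star (S.right j y) * C x y = ∑ i, (S.coeff i : ℂ) *
          ((S.left i x * star (S.left j x)) * (S.right i y * star (S.right j y))) := by
        intro x y
        rw [S.expand, Finset.mul_sum]
        exact Finset.sum_congr rfl fun i _ => by ring
      simp_rw [this]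
      rw [Finset.sum_congr rfl fun x _ => Finset.sum_comm, Finset.sum_comm]
      have h2 : ∀ i, ∑ x, ∑ y, (S.coeff i : ℂ) *
          ((S.left i x * star (S.left j x)) * (S.right i y * star (S.right j y))) =
          S.coeff i * (inner ℂ (S.left j) (S.left i) * inner ℂ (S.right j) (S.right i)) := by
        intro i
        simp only [PiLp.inner_apply, RCLike.inner_apply, Finset.sum_mul_sum]
        simp only [Finset.mul_sum]
        rfl
      simp_rw [h2, orthonormal_iff_ite.1 S.left_orthonormal, orthonormal_iff_ite.1
        S.right_orthonormal]
      simp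
    rw [← h1]
    have : ∀ x y, star (S.left j x) * star (S.right j y) * C x y = ∑ k,
          ((a k x * star (S.left j x)) * (b k y * star (S.right j y))) := by
      intro x y
      rw [h, Finset.mul_sum]
      exact Finset.sum_congr rfl fun i _ => by ring
    simp_rw [this]
    rw [Finset.sum_congr rfl fun x _ => Finset.sum_comm, Finset.sum_comm]
    refine Finset.sum_congr rfl fun k _ => ?_
    simp only [PiLp.inner_apply, RCLike.inner_apply, Finset.sum_mul_sum]
    rfl
  have h3 : (S.sum : ℂ) = ∑ k, ∑ j, inner ℂ (S.left j) (a k) * inner ℂ (S.right j) (b k) := by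
    rw [Finset.sum_comm, sum]
    push_cast
    exact Finset.sum_congr rfl fun j _ => key j
  have h4 : S.sum = ‖(S.sum : ℂ)‖ := by
    rw [Complex.norm_real, Real.norm_of_nonneg S.sum_nonneg]
  rw [h4, h3]
  refine (norm_sum_le _ _).trans (Finset.sum_le_sum fun k _ => ?_)
  refine (norm_sum_le _ _).trans ?_
  simp_rw [norm_mul]
  refine (Real.sum_mul_le_sqrt_mul_sqrt _ _ _).trans ?_
  refine mul_le_mul ?_ ?_ (Real.sqrt_nonneg _) (norm_nonneg _)
  · exact Real.sqrt_le_iff.2 ⟨norm_nonneg _, S.left_orthonormal.sum_inner_products_le _⟩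
  · exact Real.sqrt_le_iff.2 ⟨norm_nonneg _, S.right_orthonormal.sum_inner_products_le _⟩

/-- Pythagoras for the orthonormal vectors `left j ⊗ right j`. All indices give the norm of `C`; the
indices from `D` on give the truncation error. -/
theorem sum_sq_coeff (S : SchmidtDecomposition C) (J : Finset (Fin S.rank)) :
    ∑ x, ∑ y, ‖∑ j ∈ J, (S.coeff j : ℂ) * S.left j x * S.right j y‖ ^ 2 =
      ∑ j ∈ J, S.coeff j ^ 2 := by
  classical
  have h1 : ∀ x, ∑ y, ‖∑ j ∈ J, (S.coeff j : ℂ) * S.left j x * S.right j y‖ ^ 2 =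
      ∑ j ∈ J, S.coeff j ^ 2 * ‖S.left j x‖ ^ 2 := by
    intro x
    have h2 := EuclideanSpace.norm_sq_eq (∑ j ∈ J, ((S.coeff j : ℂ) * S.left j x) • S.right j)
    have h3 := S.right_orthonormal.inner_sum (fun j => (S.coeff j : ℂ) * S.left j x)
      (fun j => (S.coeff j : ℂ) * S.left j x) J
    rw [inner_self_eq_norm_sq_to_K, ← RCLike.ofReal_pow, h2] at h3
    simp only [WithLp.ofLp_sum, Finset.sum_apply, PiLp.smul_apply, smul_eq_mul] at h3
    have h4 : ∀ z : ℂ, (starRingEnd ℂ) z * z = ((‖z‖ ^ 2 : ℝ) : ℂ) := fun z => by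
      rw [RCLike.conj_mul]; push_cast; rfl
    simp_rw [h4, norm_mul, mul_pow] at h3
    have h5 : ∀ j, ‖(S.coeff j : ℂ)‖ ^ 2 = S.coeff j ^ 2 := fun j => by
      rw [Complex.norm_real, Real.norm_eq_abs, sq_abs]
    simp_rw [h5] at h3
    refine Complex.ofReal_injective (Eq.trans h3 ?_)
    push_cast
    rfl
  simp_rw [h1]
  rw [Finset.sum_comm]
  refine Finset.sum_congr rfl fun j _ => ?_
  rw [← Finset.mul_sum, ← EuclideanSpace.norm_sq_eq, S.left_orthonormal.1 j]
  simp

theorem sum_sq_amp (S : SchmidtDecomposition C) :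
    ∑ x, ∑ y, ‖C x y‖ ^ 2 = ∑ j, S.coeff j ^ 2 := by
  rw [← S.sum_sq_coeff Finset.univ]
  simp_rw [S.expand]

/-- Each coefficient with index at least `D` is dominated by the `D` first ones, hence is at most
`S.sum / D`; one factor of each square is bounded this way. -/
theorem tail_le (S : SchmidtDecomposition C) {D : ℕ} (hD : 1 ≤ D) :
    S.tail D ≤ S.sum / Real.sqrt D := by
  have hD0 : (0 : ℝ) < D := by exact_mod_cast hD
  have hs : 0 < Real.sqrt D := Real.sqrt_pos.2 hD0
  refine Real.sqrt_le_iff.2 ⟨div_nonneg S.sum_nonneg hs.le, ?_⟩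
  rw [div_pow, Real.sq_sqrt hD0.le, le_div_iff₀ hD0, Finset.sum_mul, sq]
  conv_rhs => rw [sum, Finset.sum_mul]
  refine (Finset.sum_le_sum (g := fun j => S.coeff j * S.sum) fun j hj => ?_).trans
    (Finset.sum_le_sum_of_subset_of_nonneg (Finset.subset_univ _)
      fun j _ _ => mul_nonneg (S.coeff_pos j).le S.sum_nonneg)
  have hDj : D ≤ j.val := (Finset.mem_filter.1 hj).2
  rw [sq, mul_assoc]
  refine mul_le_mul_of_nonneg_left ?_ (S.coeff_pos j).le
  have hcard : (Finset.univ.map (Fin.castLEEmb (hDj.trans j.2.le))).card = D := by simp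
  calc S.coeff j * D
      = ∑ i ∈ Finset.univ.map (Fin.castLEEmb (hDj.trans j.2.le)), S.coeff j := by
        rw [Finset.sum_const, hcard, nsmul_eq_mul, mul_comm]
    _ ≤ ∑ i ∈ Finset.univ.map (Fin.castLEEmb (hDj.trans j.2.le)), S.coeff i := by
        refine Finset.sum_le_sum fun i hi => ?_
        obtain ⟨k, _, rfl⟩ := Finset.mem_map.1 hi
        exact S.coeff_antitone (Fin.le_def.2 (k.2.le.trans hDj))
    _ ≤ S.sum := Finset.sum_le_sum_of_subset_of_nonneg (Finset.subset_univ _)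
        fun i _ _ => (S.coeff_pos i).le

/-- Contracting `C` with the conjugate of `right j` shows that `left j` lies in the span of the `a
k`, and the left vectors are independent. -/
theorem rank_le {ι : Type*} [Fintype ι] (S : SchmidtDecomposition C)
    (a : ι → α → ℂ) (b : ι → β → ℂ) (h : ∀ x y, C x y = ∑ k, a k x * b k y) :
    S.rank ≤ Fintype.card ι := by
  classical
  have hmem : ∀ j, S.left j ∈ Submodule.span ℂ (Set.range fun k => WithLp.toLp 2 (a k)) := by
    intro j
    have h1 : S.left j = ∑ k, ((S.coeff j : ℂ)⁻¹ * ∑ y, star (S.right j y) * b k y) •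
        WithLp.toLp 2 (a k) := by
      ext x
      have hj : (S.coeff j : ℂ) ≠ 0 := by exact_mod_cast (S.coeff_pos j).ne'
      have h2 : ∑ y, star (S.right j y) * C x y = S.coeff j * S.left j x := by
        simp_rw [S.expand, Finset.mul_sum]
        rw [Finset.sum_comm]
        have : ∀ i, ∑ y, star (S.right j y) * ((S.coeff i : ℂ) * S.left i x * S.right i y) =
            S.coeff i * S.left i x * inner ℂ (S.right j) (S.right i) := by
          intro i
          simp only [PiLp.inner_apply, RCLike.inner_apply, Finset.mul_sum]
          refine Finset.sum_congr rfl fun y _ => ?_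
          simp only [RCLike.star_def]
          ring
        simp_rw [this, orthonormal_iff_ite.1 S.right_orthonormal]
        simp
      have h3 : S.left j x = (S.coeff j : ℂ)⁻¹ * ∑ y, star (S.right j y) * C x y := by
        rw [h2]; field_simp
      rw [h3]
      simp_rw [h, Finset.mul_sum]
      rw [Finset.sum_comm]
      simp only [WithLp.ofLp_sum, Finset.sum_apply, PiLp.smul_apply, smul_eq_mul, Finset.sum_mul]
      exact Finset.sum_congr rfl fun k _ => Finset.sum_congr rfl fun y _ => by ring
    rw [h1]
    exact Submodule.sum_mem _ fun k _ => Submodule.smul_mem _ _ (Submodule.subset_span ⟨k, rfl⟩)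
  have hli : LinearIndependent ℂ fun j => (⟨S.left j, hmem j⟩ :
      Submodule.span ℂ (Set.range fun k => WithLp.toLp 2 (a k))) :=
    LinearIndependent.of_comp (Submodule.subtype _) S.left_orthonormal.linearIndependent
  have := hli.fintype_card_le_finrank
  rw [Fintype.card_fin] at this
  exact this.trans (finrank_range_le_card _)

theorem sum_le_sqrt_rank (S : SchmidtDecomposition C) :
    S.sum ≤ Real.sqrt S.rank * Real.sqrt (∑ x, ∑ y, ‖C x y‖ ^ 2) := by
  have h := Real.sum_mul_le_sqrt_mul_sqrt Finset.univ (fun _ : Fin S.rank => (1 : ℝ)) S.coeff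
  simpa [sum_sq_amp S, sum] using h

end SchmidtDecomposition

/-! ### The sum of the Schmidt coefficients as a norm. -/

section nuclear

variable {α β : Type} [Fintype α] [Fintype β]

/-- The sum of the Schmidt coefficients of a bipartite vector. -/
noncomputable def nuclearNorm (C : α → β → ℂ) : ℝ :=
  (SchmidtDecomposition.exists_schmidtDecomposition C).some.sum

theorem nuclearNorm_nonneg (C : α → β → ℂ) : 0 ≤ nuclearNorm C :=
  SchmidtDecomposition.sum_nonneg _

theorem nuclearNorm_le {C : α → β → ℂ} {ι : Type*} [Fintype ι]
    (a : ι → EuclideanSpace ℂ α) (b : ι → EuclideanSpace ℂ β)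
    (h : ∀ x y, C x y = ∑ k, a k x * b k y) : nuclearNorm C ≤ ∑ k, ‖a k‖ * ‖b k‖ :=
  SchmidtDecomposition.sum_le _ a b h

theorem SchmidtDecomposition.sum_mul_norm {C : α → β → ℂ} (S : SchmidtDecomposition C) :
    ∑ j, ‖(S.coeff j : ℂ) • S.left j‖ * ‖S.right j‖ = S.sum := by
  refine Finset.sum_congr rfl fun j _ => ?_
  rw [norm_smul, S.left_orthonormal.1, S.right_orthonormal.1, Complex.norm_real,
    Real.norm_of_nonneg (S.coeff_pos j).le]
  ring

/-- Each of two Schmidt decompositions is an expansion to which minimality of the other applies, so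
the arbitrary choice in `nuclearNorm` is harmless. -/
theorem SchmidtDecomposition.sum_eq_nuclearNorm {C : α → β → ℂ} (S : SchmidtDecomposition C) :
    S.sum = nuclearNorm C := by
  refine le_antisymm ?_ ?_
  · set S' := (SchmidtDecomposition.exists_schmidtDecomposition C).some with hS'
    have := S.sum_le (fun j => (S'.coeff j : ℂ) • S'.left j) S'.right S'.expand
    rwa [S'.sum_mul_norm] at this
  · have := nuclearNorm_le (fun j => (S.coeff j : ℂ) • S.left j) S.right S.expand
    rwa [S.sum_mul_norm] at this

theorem exists_nuclear_decomposition (C : α → β → ℂ) :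
    ∃ (r : ℕ) (a : Fin r → EuclideanSpace ℂ α) (b : Fin r → EuclideanSpace ℂ β),
      (∀ x y, C x y = ∑ k, a k x * b k y) ∧ ∑ k, ‖a k‖ * ‖b k‖ = nuclearNorm C := by
  set S := (SchmidtDecomposition.exists_schmidtDecomposition C).some with hS
  exact ⟨S.rank, fun j => (S.coeff j : ℂ) • S.left j, S.right, S.expand, S.sum_mul_norm⟩

/-- Optimal expansions of the summands concatenate to an expansion of the sum. -/
theorem nuclearNorm_sum_le {ι : Type*} (s : Finset ι) (C : ι → α → β → ℂ) :
    nuclearNorm (fun x y => ∑ i ∈ s, C i x y) ≤ ∑ i ∈ s, nuclearNorm (C i) := by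
  choose r a b h1 h2 using fun i => exists_nuclear_decomposition (C i)
  rw [← Finset.sum_coe_sort s]
  have := nuclearNorm_le (C := fun x y => ∑ i ∈ s, C i x y)
    (fun k : (i : s) × Fin (r i) => a k.1 k.2) (fun k => b k.1 k.2) (fun x y => by
      rw [Fintype.sum_sigma, ← Finset.sum_coe_sort s]
      exact Finset.sum_congr rfl fun i _ => h1 i x y)
  rw [Fintype.sum_sigma] at this
  simpa only [h2] using this

theorem nuclearNorm_add_le (C C' : α → β → ℂ) :
    nuclearNorm (fun x y => C x y + C' x y) ≤ nuclearNorm C + nuclearNorm C' := by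
  simpa [Fintype.sum_bool] using nuclearNorm_sum_le Finset.univ
    (fun i : Bool => if i then C else C')

theorem nuclearNorm_smul_le (c : ℂ) (C : α → β → ℂ) :
    nuclearNorm (fun x y => c * C x y) ≤ ‖c‖ * nuclearNorm C := by
  obtain ⟨r, a, b, h1, h2⟩ := exists_nuclear_decomposition C
  have := nuclearNorm_le (C := fun x y => c * C x y) (fun k => c • a k) b (fun x y => by
    rw [h1, Finset.mul_sum]
    exact Finset.sum_congr rfl fun k _ => by simp [mul_assoc])
  simpa only [norm_smul, mul_assoc, ← Finset.mul_sum, h2] using this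

end nuclear

variable {n d : ℕ}

/-! ### Gluing and slicing -/

@[simp] theorem lpart_glue (s : ℕ) (a : LCfg n d s) (b : RCfg n d s) : lpart s (glue s a b) = a := by
  funext i
  simp [lpart, glue, i.2]

@[simp] theorem rpart_glue (s : ℕ) (a : LCfg n d s) (b : RCfg n d s) : rpart s (glue s a b) = b := by
  funext i
  simp only [rpart, glue]
  rw [dif_neg i.2]

@[simp] theorem glue_lpart_rpart (s : ℕ) (x : Cfg n d) : glue s (lpart s x) (rpart s x) = x := by
  funext i
  simp [lpart, rpart, glue]

/-- Configurations of the chain as pairs of configurations of the two sides of a cut. -/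
def cutEquiv (s : ℕ) : Cfg n d ≃ LCfg n d s × RCfg n d s where
  toFun x := (lpart s x, rpart s x)
  invFun p := glue s p.1 p.2
  left_inv x := glue_lpart_rpart s x
  right_inv p := by simp

theorem sum_cfg_eq {M : Type*} [AddCommMonoid M] (s : ℕ) (f : Cfg n d → M) :
    ∑ x, f x = ∑ a, ∑ b, f (glue s a b) := by
  rw [← (cutEquiv s).symm.sum_comp f, Fintype.sum_prod_type]
  rfl

theorem norm_sq_chain (s : ℕ) (ψ : Chain n d) : ‖ψ‖ ^ 2 = ∑ a, ∑ b, ‖ψ (glue s a b)‖ ^ 2 := by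
  rw [EuclideanSpace.norm_sq_eq, sum_cfg_eq s]

/-- The tensor product of a vector left of the cut and a vector right of the cut. -/
noncomputable def tens (s : ℕ) (a : EuclideanSpace ℂ (LCfg n d s))
    (b : EuclideanSpace ℂ (RCfg n d s)) : Chain n d :=
  WithLp.toLp 2 fun x => a (lpart s x) * b (rpart s x)

@[simp] theorem tens_apply (s : ℕ) (a : EuclideanSpace ℂ (LCfg n d s))
    (b : EuclideanSpace ℂ (RCfg n d s)) (x : Cfg n d) :
    tens s a b x = a (lpart s x) * b (rpart s x) := rfl

theorem norm_tens (s : ℕ) (a : EuclideanSpace ℂ (LCfg n d s)) (b : EuclideanSpace ℂ (RCfg n d s)) :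
    ‖tens s a b‖ = ‖a‖ * ‖b‖ := by
  rw [← sq_eq_sq₀ (norm_nonneg _) (by positivity), norm_sq_chain s, mul_pow,
    EuclideanSpace.norm_sq_eq a, EuclideanSpace.norm_sq_eq b, Finset.sum_mul_sum]
  simp [mul_pow]

/-- The restriction of `ψ` to a fixed configuration `a` left of the cut. -/
noncomputable def sliceRight (s : ℕ) (a : LCfg n d s) (ψ : Chain n d) :
    EuclideanSpace ℂ (RCfg n d s) :=
  WithLp.toLp 2 fun b => ψ (glue s a b)

/-- The restriction of `ψ` to a fixed configuration `b` right of the cut. -/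
noncomputable def sliceLeft (s : ℕ) (b : RCfg n d s) (ψ : Chain n d) :
    EuclideanSpace ℂ (LCfg n d s) :=
  WithLp.toLp 2 fun a => ψ (glue s a b)

theorem norm_sq_eq_sum_sliceRight (s : ℕ) (ψ : Chain n d) :
    ‖ψ‖ ^ 2 = ∑ a, ‖sliceRight s a ψ‖ ^ 2 := by
  rw [norm_sq_chain s]
  simp_rw [EuclideanSpace.norm_sq_eq]
  rfl

theorem norm_sq_eq_sum_sliceLeft (s : ℕ) (ψ : Chain n d) :
    ‖ψ‖ ^ 2 = ∑ b, ‖sliceLeft s b ψ‖ ^ 2 := by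
  rw [norm_sq_chain s, Finset.sum_comm]
  simp_rw [EuclideanSpace.norm_sq_eq]
  rfl

theorem sliceRight_add (s : ℕ) (a : LCfg n d s) (ψ φ : Chain n d) :
    sliceRight s a (ψ + φ) = sliceRight s a ψ + sliceRight s a φ := rfl

theorem sliceRight_sub (s : ℕ) (a : LCfg n d s) (ψ φ : Chain n d) :
    sliceRight s a (ψ - φ) = sliceRight s a ψ - sliceRight s a φ := rfl

theorem sliceRight_smul (s : ℕ) (a : LCfg n d s) (c : ℂ) (ψ : Chain n d) :
    sliceRight s a (c • ψ) = c • sliceRight s a ψ := rfl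

theorem sliceLeft_add (s : ℕ) (b : RCfg n d s) (ψ φ : Chain n d) :
    sliceLeft s b (ψ + φ) = sliceLeft s b ψ + sliceLeft s b φ := rfl

theorem sliceLeft_smul (s : ℕ) (b : RCfg n d s) (c : ℂ) (ψ : Chain n d) :
    sliceLeft s b (c • ψ) = c • sliceLeft s b ψ := rfl

/-- The operator `1 ⊗ p`. -/
noncomputable def liftRight (s : ℕ)
    (p : EuclideanSpace ℂ (RCfg n d s) →L[ℂ] EuclideanSpace ℂ (RCfg n d s)) : Op n d :=
  LinearMap.toContinuousLinearMap
    { toFun := fun ψ => WithLp.toLp 2 fun x => p (sliceRight s (lpart s x) ψ) (rpart s x)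
      map_add' := fun ψ φ => by ext x; simp [sliceRight_add]
      map_smul' := fun c ψ => by ext x; simp [sliceRight_smul] }

/-- The operator `p ⊗ 1`. -/
noncomputable def liftLeft (s : ℕ)
    (p : EuclideanSpace ℂ (LCfg n d s) →L[ℂ] EuclideanSpace ℂ (LCfg n d s)) : Op n d :=
  LinearMap.toContinuousLinearMap
    { toFun := fun ψ => WithLp.toLp 2 fun x => p (sliceLeft s (rpart s x) ψ) (lpart s x)
      map_add' := fun ψ φ => by ext x; simp [sliceLeft_add]
      map_smul' := fun c ψ => by ext x; simp [sliceLeft_smul] }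

theorem liftRight_apply (s : ℕ)
    (p : EuclideanSpace ℂ (RCfg n d s) →L[ℂ] EuclideanSpace ℂ (RCfg n d s)) (ψ : Chain n d)
    (x : Cfg n d) : liftRight s p ψ x = p (sliceRight s (lpart s x) ψ) (rpart s x) := rfl

theorem liftLeft_apply (s : ℕ)
    (p : EuclideanSpace ℂ (LCfg n d s) →L[ℂ] EuclideanSpace ℂ (LCfg n d s)) (ψ : Chain n d)
    (x : Cfg n d) : liftLeft s p ψ x = p (sliceLeft s (rpart s x) ψ) (lpart s x) := rfl

theorem sliceRight_liftRight (s : ℕ)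
    (p : EuclideanSpace ℂ (RCfg n d s) →L[ℂ] EuclideanSpace ℂ (RCfg n d s)) (a : LCfg n d s)
    (ψ : Chain n d) : sliceRight s a (liftRight s p ψ) = p (sliceRight s a ψ) := by
  ext b
  simp [sliceRight, liftRight_apply]

theorem sliceLeft_liftLeft (s : ℕ)
    (p : EuclideanSpace ℂ (LCfg n d s) →L[ℂ] EuclideanSpace ℂ (LCfg n d s)) (b : RCfg n d s)
    (ψ : Chain n d) : sliceLeft s b (liftLeft s p ψ) = p (sliceLeft s b ψ) := by
  ext a
  simp [sliceLeft, liftLeft_apply]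

theorem liftRight_tens (s : ℕ)
    (p : EuclideanSpace ℂ (RCfg n d s) →L[ℂ] EuclideanSpace ℂ (RCfg n d s))
    (a : EuclideanSpace ℂ (LCfg n d s)) (b : EuclideanSpace ℂ (RCfg n d s)) :
    liftRight s p (tens s a b) = tens s a (p b) := by
  ext x
  have : sliceRight s (lpart s x) (tens s a b) = a (lpart s x) • b := by
    ext y; simp [sliceRight]
  rw [liftRight_apply, this, map_smul]
  simp

theorem liftLeft_tens (s : ℕ)
    (p : EuclideanSpace ℂ (LCfg n d s) →L[ℂ] EuclideanSpace ℂ (LCfg n d s))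
    (a : EuclideanSpace ℂ (LCfg n d s)) (b : EuclideanSpace ℂ (RCfg n d s)) :
    liftLeft s p (tens s a b) = tens s (p a) b := by
  ext x
  have : sliceLeft s (rpart s x) (tens s a b) = b (rpart s x) • a := by
    ext y; simp [sliceLeft, mul_comm]
  rw [liftLeft_apply, this, map_smul]
  simp [mul_comm]

theorem norm_liftLeft_le (s : ℕ)
    (p : EuclideanSpace ℂ (LCfg n d s) →L[ℂ] EuclideanSpace ℂ (LCfg n d s)) (hp : ‖p‖ ≤ 1) :
    ‖liftLeft s p‖ ≤ 1 := by
  refine ContinuousLinearMap.opNorm_le_bound _ zero_le_one fun ψ => ?_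
  rw [one_mul, ← sq_le_sq₀ (norm_nonneg _) (norm_nonneg _), norm_sq_eq_sum_sliceLeft s,
    norm_sq_eq_sum_sliceLeft s ψ]
  refine Finset.sum_le_sum fun b _ => pow_le_pow_left₀ (norm_nonneg _) ?_ 2
  rw [sliceLeft_liftLeft]
  simpa using p.le_of_opNorm_le hp (sliceLeft s b ψ)

theorem norm_liftRight_le (s : ℕ)
    (p : EuclideanSpace ℂ (RCfg n d s) →L[ℂ] EuclideanSpace ℂ (RCfg n d s)) (hp : ‖p‖ ≤ 1) :
    ‖liftRight s p‖ ≤ 1 := by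
  refine ContinuousLinearMap.opNorm_le_bound _ zero_le_one fun ψ => ?_
  rw [one_mul, ← sq_le_sq₀ (norm_nonneg _) (norm_nonneg _), norm_sq_eq_sum_sliceRight s,
    norm_sq_eq_sum_sliceRight s ψ]
  refine Finset.sum_le_sum fun b _ => pow_le_pow_left₀ (norm_nonneg _) ?_ 2
  rw [sliceRight_liftRight]
  simpa using p.le_of_opNorm_le hp (sliceRight s b ψ)

/-! ### Locality -/

/-- The sites left of the cut. -/
def leftSites (n s : ℕ) : Finset (Fin n) := Finset.univ.filter fun i => i.val < s

/-- The sites right of the cut. -/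
def rightSites (n s : ℕ) : Finset (Fin n) := Finset.univ.filter fun i => ¬ i.val < s

@[simp] theorem mem_leftSites {s : ℕ} {i : Fin n} : i ∈ leftSites n s ↔ i.val < s := by
  simp [leftSites]

@[simp] theorem mem_rightSites {s : ℕ} {i : Fin n} : i ∈ rightSites n s ↔ ¬ i.val < s := by
  simp [rightSites]

theorem leftSites_mono {s s' : ℕ} (h : s ≤ s') : leftSites n s ⊆ leftSites n s' := fun i hi => by
  simp only [mem_leftSites] at *
  omega

theorem rightSites_anti {s s' : ℕ} (h : s ≤ s') : rightSites n s' ⊆ rightSites n s := fun i hi => by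
  simp only [mem_rightSites] at *
  omega

theorem piecewise_leftSites (s : ℕ) (x r : Cfg n d) :
    (leftSites n s).piecewise x r = glue s (lpart s x) (rpart s r) := by
  funext i
  simp only [Finset.piecewise, mem_leftSites, glue, lpart, rpart]
  rfl

theorem piecewise_rightSites (s : ℕ) (x r : Cfg n d) :
    (rightSites n s).piecewise x r = glue s (lpart s r) (rpart s x) := by
  funext i
  by_cases h : i.val < s <;> simp [Finset.piecewise, glue, lpart, rpart, h]

/-- The operator acts on the sites in `Z` only, uniformly in the configuration of the other
sites. -/
def ActsOn (Z : Finset (Fin n)) (O : Op n d) : Prop :=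
  ∀ (ψ ψ' : Chain n d) (r r' : Cfg n d),
    (∀ x : Cfg n d, ψ (Z.piecewise x r) = ψ' (Z.piecewise x r')) →
      ∀ x : Cfg n d, O ψ (Z.piecewise x r) = O ψ' (Z.piecewise x r')

/-- A configuration on `Z'` refines the outside of `Z`: the condition for `Z` is used with the sites
of `Z'` outside `Z` frozen at their values in `x`. -/
theorem ActsOn.mono {Z Z' : Finset (Fin n)} {O : Op n d} (h : ActsOn Z O) (hZ : Z ⊆ Z') :
    ActsOn Z' O := by
  intro ψ ψ' r r' hψ x
  have e : ∀ (w x r : Cfg n d),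
      Z.piecewise w (Z'.piecewise x r) = Z'.piecewise (Z.piecewise w x) r := by
    intro w x r
    funext i
    by_cases hi : i ∈ Z
    · simp [Finset.piecewise, hi, hZ hi]
    · simp [Finset.piecewise, hi]
  have := h ψ ψ' (Z'.piecewise x r) (Z'.piecewise x r')
    (fun w => by rw [e, e]; exact hψ _) x
  rwa [e, e, show Z.piecewise x x = x by funext i; simp [Finset.piecewise]] at this

theorem ActsOn.comp {Z : Finset (Fin n)} {O O' : Op n d} (h : ActsOn Z O) (h' : ActsOn Z O') :
    ActsOn Z (O * O') := fun ψ ψ' r r' hψ =>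
  h (O' ψ) (O' ψ') r r' (h' ψ ψ' r r' hψ)

theorem ActsOn.one (Z : Finset (Fin n)) : ActsOn Z (1 : Op n d) := fun _ _ _ _ hψ => hψ

theorem ActsOn.sub {Z : Finset (Fin n)} {O O' : Op n d} (h : ActsOn Z O) (h' : ActsOn Z O') :
    ActsOn Z (O - O') := fun ψ ψ' r r' hψ x => by
  simp [h ψ ψ' r r' hψ x, h' ψ ψ' r r' hψ x]

theorem ActsOn.smul {Z : Finset (Fin n)} {O : Op n d} (h : ActsOn Z O) (c : ℂ) :
    ActsOn Z (c • O) := fun ψ ψ' r r' hψ x => by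
  simp [h ψ ψ' r r' hψ x]

theorem ActsOn.sum {ι : Type*} {J : Finset ι} {Z : Finset (Fin n)} {O : ι → Op n d}
    (h : ∀ i ∈ J, ActsOn Z (O i)) : ActsOn Z (∑ i ∈ J, O i) := fun ψ ψ' r r' hψ x => by
  simp only [sum_apply, WithLp.ofLp_sum, Finset.sum_apply]
  exact Finset.sum_congr rfl fun i hi => h i hi ψ ψ' r r' hψ x

theorem SupportedOn.actsOn {Z : Finset (Fin n)} {O : Op n d} (h : SupportedOn Z O) :
    ActsOn Z O := by
  obtain ⟨K, hK⟩ := h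
  intro ψ ψ' r r' hψ x
  rw [hK, hK]
  have e1 : ∀ r : Cfg n d, (fun i : {i // i ∈ Z} => Z.piecewise x r i.1) = fun i => x i.1 := by
    intro r
    funext i
    simp [Finset.piecewise, i.2]
  have e2 : ∀ (z : {i // i ∈ Z} → Fin d) (r : Cfg n d),
      (fun i => if h : i ∈ Z then z ⟨i, h⟩ else Z.piecewise x r i) =
        Z.piecewise (fun i => if h : i ∈ Z then z ⟨i, h⟩ else x i) r := by
    intro z r
    funext i
    by_cases hi : i ∈ Z <;> simp [Finset.piecewise, hi]
  simp_rw [e1, e2, hψ]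

theorem actsOn_liftLeft (s : ℕ)
    (p : EuclideanSpace ℂ (LCfg n d s) →L[ℂ] EuclideanSpace ℂ (LCfg n d s)) :
    ActsOn (leftSites n s) (liftLeft s p) := by
  intro ψ ψ' r r' hψ x
  simp only [piecewise_leftSites, liftLeft_apply, lpart_glue, rpart_glue] at *
  have : sliceLeft s (rpart s r) ψ = sliceLeft s (rpart s r') ψ' := by
    ext a
    simpa [sliceLeft] using hψ (glue s a (rpart s r))
  rw [this]

theorem actsOn_liftRight (s : ℕ)
    (p : EuclideanSpace ℂ (RCfg n d s) →L[ℂ] EuclideanSpace ℂ (RCfg n d s)) :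
    ActsOn (rightSites n s) (liftRight s p) := by
  intro ψ ψ' r r' hψ x
  simp only [piecewise_rightSites, liftRight_apply, lpart_glue, rpart_glue] at *
  have : sliceRight s (lpart s r) ψ = sliceRight s (lpart s r') ψ' := by
    ext b
    simpa [sliceRight] using hψ (glue s (lpart s r) b)
  rw [this]

/-- Product vectors stay product vectors with unchanged right factor. This is all that is needed
below, so `L` is a bare map and not an operator. -/
theorem ActsOn.exists_left {s : ℕ} {O : Op n d} (h : ActsOn (leftSites n s) O) :
    ∃ L : EuclideanSpace ℂ (LCfg n d s) → EuclideanSpace ℂ (LCfg n d s),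
      ∀ a b, O (tens s a b) = tens s (L a) b := by
  rcases isEmpty_or_nonempty (Cfg n d) with he | ⟨⟨r⟩⟩
  · exact ⟨id, fun a b => by ext x; exact he.elim x⟩
  -- The right factor is replaced by the constant vector `1`: on the slice at a fixed right
  -- configuration, `b` is only a scalar.
  · refine ⟨fun a => sliceLeft s (rpart s r) (O (tens s a (WithLp.toLp 2 fun _ => 1))),
      fun a b => ?_⟩
    ext x
    have := h (tens s a b) (b (rpart s x) • tens s a (WithLp.toLp 2 fun _ => 1)) x r
      (fun w => by simp [piecewise_leftSites, mul_comm]) x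
    rw [piecewise_leftSites, piecewise_leftSites, glue_lpart_rpart] at this
    rw [this]
    simp [sliceLeft, mul_comm]

theorem ActsOn.exists_right {s : ℕ} {O : Op n d} (h : ActsOn (rightSites n s) O) :
    ∃ R : EuclideanSpace ℂ (RCfg n d s) → EuclideanSpace ℂ (RCfg n d s),
      ∀ a b, O (tens s a b) = tens s a (R b) := by
  rcases isEmpty_or_nonempty (Cfg n d) with he | ⟨⟨r⟩⟩
  · exact ⟨id, fun a b => by ext x; exact he.elim x⟩
  · refine ⟨fun b => sliceRight s (lpart s r) (O (tens s (WithLp.toLp 2 fun _ => 1) b)),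
      fun a b => ?_⟩
    ext x
    have := h (tens s a b) (a (lpart s x) • tens s (WithLp.toLp 2 fun _ => 1) b) x r
      (fun w => by simp [piecewise_rightSites]) x
    rw [piecewise_rightSites, piecewise_rightSites, glue_lpart_rpart] at this
    rw [this]
    simp [sliceRight]

/-! ### The sum of the Schmidt coefficients at a cut -/

/-- The sum of the Schmidt coefficients of `ψ` for the cut after the first `s` sites. -/
noncomputable def cutNorm (s : ℕ) (ψ : Chain n d) : ℝ := nuclearNorm (cutAmp s ψ)

theorem cutNorm_nonneg (s : ℕ) (ψ : Chain n d) : 0 ≤ cutNorm s ψ := nuclearNorm_nonneg _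

theorem eq_sum_tens_iff {ι : Type*} [Fintype ι] (s : ℕ) (ψ : Chain n d)
    (a : ι → EuclideanSpace ℂ (LCfg n d s)) (b : ι → EuclideanSpace ℂ (RCfg n d s)) :
    ψ = ∑ k, tens s (a k) (b k) ↔ ∀ x y, cutAmp s ψ x y = ∑ k, a k x * b k y := by
  constructor
  · rintro h x y
    rw [cutAmp, h]
    simp
  · intro h
    ext x
    have := h (lpart s x) (rpart s x)
    rw [cutAmp, glue_lpart_rpart] at this
    rw [this]
    simp

theorem exists_cut_decomposition (s : ℕ) (ψ : Chain n d) :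
    ∃ (r : ℕ) (a : Fin r → EuclideanSpace ℂ (LCfg n d s)) (b : Fin r → EuclideanSpace ℂ (RCfg n d s)),
      ψ = ∑ k, tens s (a k) (b k) ∧ ∑ k, ‖a k‖ * ‖b k‖ = cutNorm s ψ := by
  obtain ⟨r, a, b, h1, h2⟩ := exists_nuclear_decomposition (cutAmp s ψ)
  exact ⟨r, a, b, (eq_sum_tens_iff s ψ a b).2 h1, h2⟩

theorem cutNorm_le {ι : Type*} [Fintype ι] {s : ℕ} {ψ : Chain n d}
    {a : ι → EuclideanSpace ℂ (LCfg n d s)} {b : ι → EuclideanSpace ℂ (RCfg n d s)}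
    (h : ψ = ∑ k, tens s (a k) (b k)) : cutNorm s ψ ≤ ∑ k, ‖a k‖ * ‖b k‖ :=
  nuclearNorm_le a b ((eq_sum_tens_iff s ψ a b).1 h)

theorem cutNorm_tens_le (s : ℕ) (a : EuclideanSpace ℂ (LCfg n d s))
    (b : EuclideanSpace ℂ (RCfg n d s)) : cutNorm s (tens s a b) ≤ ‖a‖ * ‖b‖ := by
  simpa using cutNorm_le (ι := Unit) (a := fun _ => a) (b := fun _ => b)
    (ψ := tens s a b) (by simp)

theorem cutNorm_add_le (s : ℕ) (ψ φ : Chain n d) :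
    cutNorm s (ψ + φ) ≤ cutNorm s ψ + cutNorm s φ :=
  nuclearNorm_add_le (cutAmp s ψ) (cutAmp s φ)

theorem cutNorm_smul_le (s : ℕ) (c : ℂ) (ψ : Chain n d) :
    cutNorm s (c • ψ) ≤ ‖c‖ * cutNorm s ψ :=
  nuclearNorm_smul_le c (cutAmp s ψ)

theorem cutNorm_sum_le {ι : Type*} (J : Finset ι) (s : ℕ) (ψ : ι → Chain n d) :
    cutNorm s (∑ i ∈ J, ψ i) ≤ ∑ i ∈ J, cutNorm s (ψ i) := by
  have : cutAmp s (∑ i ∈ J, ψ i) = fun x y => ∑ i ∈ J, cutAmp s (ψ i) x y := by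
    funext x y
    simp [cutAmp]
  rw [cutNorm, this]
  exact nuclearNorm_sum_le J _

/-- Both operators are applied termwise to an optimal expansion. Every term stays a product vector,
whose norm is the product of the norms of its factors, so the ordinary operator norms suffice. -/
theorem cutNorm_local_le {s : ℕ} {O O' : Op n d} (h : ActsOn (leftSites n s) O)
    (h' : ActsOn (rightSites n s) O') (ψ : Chain n d) :
    cutNorm s (O (O' ψ)) ≤ ‖O‖ * ‖O'‖ * cutNorm s ψ := by
  obtain ⟨L, hL⟩ := h.exists_left
  obtain ⟨R, hR⟩ := h'.exists_right
  obtain ⟨r, a, b, h1, h2⟩ := exists_cut_decomposition s ψ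
  have key : ∀ k, cutNorm s (O (O' (tens s (a k) (b k)))) ≤ ‖O‖ * ‖O'‖ * (‖a k‖ * ‖b k‖) := by
    intro k
    have hO' := O'.le_opNorm (tens s (a k) (b k))
    rw [hR, norm_tens, norm_tens] at hO'
    have hO := O.le_opNorm (tens s (a k) (R (b k)))
    rw [hL, norm_tens, norm_tens] at hO
    rw [hR, hL]
    refine (cutNorm_tens_le s _ _).trans (hO.trans ?_)
    rw [mul_assoc]
    exact mul_le_mul_of_nonneg_left hO' (norm_nonneg _)
  rw [← h2, Finset.mul_sum]
  conv_lhs => rw [h1, map_sum, map_sum]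
  exact (cutNorm_sum_le _ s _).trans (Finset.sum_le_sum fun k _ => key k)

theorem ActsOn.apply_comm {s : ℕ} {O O' : Op n d} (h : ActsOn (leftSites n s) O)
    (h' : ActsOn (rightSites n s) O') (ψ : Chain n d) : O (O' ψ) = O' (O ψ) := by
  obtain ⟨L, hL⟩ := h.exists_left
  obtain ⟨R, hR⟩ := h'.exists_right
  obtain ⟨r, a, b, h1, h2⟩ := exists_cut_decomposition s ψ
  rw [h1]
  simp only [map_sum, hL, hR]

/-! ### Orthogonal projections onto parts of an orthonormal family. -/

section orthProj

variable {E ι : Type*} [NormedAddCommGroup E] [InnerProductSpace ℂ E]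

/-- The orthogonal projection onto the span of the members of the orthonormal family `u` with index
in `J`. -/
noncomputable def orthProj (u : ι → E) (J : Finset ι) : E →L[ℂ] E :=
  ∑ j ∈ J, (innerSL ℂ (u j)).smulRight (u j)

theorem orthProj_apply (u : ι → E) (J : Finset ι) (v : E) :
    orthProj u J v = ∑ j ∈ J, inner ℂ (u j) v • u j := by
  simp [orthProj, sum_apply]

theorem orthProj_self [DecidableEq ι] {u : ι → E} (hu : Orthonormal ℂ u) (J : Finset ι) (i : ι) :
    orthProj u J (u i) = if i ∈ J then u i else 0 := by
  rw [orthProj_apply]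
  simp_rw [orthonormal_iff_ite.1 hu]
  simp

theorem inner_orthProj_sub {u : ι → E} (hu : Orthonormal ℂ u) (J : Finset ι) (v w : E) :
    inner ℂ (v - orthProj u J v) (orthProj u J w) = 0 := by
  classical
  rw [orthProj_apply u J w, inner_sum]
  refine Finset.sum_eq_zero fun j hj => ?_
  rw [inner_smul_right, inner_sub_left, orthProj_apply, hu.inner_left_sum _ hj,
    inner_conj_symm, sub_self, mul_zero]

/-- Pythagoras for `v - P w = (v - P v) + P (v - w)`. -/
theorem norm_sub_orthProj_sq {u : ι → E} (hu : Orthonormal ℂ u) (J : Finset ι) (v w : E) :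
    ‖v - orthProj u J w‖ ^ 2 = ‖v - orthProj u J v‖ ^ 2 + ‖orthProj u J (v - w)‖ ^ 2 := by
  have h := norm_add_sq_eq_norm_sq_add_norm_sq_of_inner_eq_zero _ _
    (inner_orthProj_sub hu J v (v - w))
  rw [map_sub, sub_add_sub_cancel, ← map_sub] at h
  simpa only [sq] using h

theorem norm_orthProj_apply_le {u : ι → E} (hu : Orthonormal ℂ u) (J : Finset ι) (v : E) :
    ‖orthProj u J v‖ ≤ ‖v‖ := by
  have h := norm_sub_orthProj_sq hu J v 0
  rw [map_zero, sub_zero] at h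
  exact le_of_sq_le_sq (by nlinarith [sq_nonneg ‖v - orthProj u J v‖]) (norm_nonneg _)

theorem norm_orthProj_le {u : ι → E} (hu : Orthonormal ℂ u) (J : Finset ι) :
    ‖orthProj u J‖ ≤ 1 :=
  ContinuousLinearMap.opNorm_le_bound _ zero_le_one fun v => by
    simpa using norm_orthProj_apply_le hu J v

end orthProj

/-! ### The projections of the truncation -/

theorem projRight_eq (s D : ℕ) {C : LCfg n d s → RCfg n d s → ℂ} (S : SchmidtDecomposition C)
    (φ : Chain n d) : projRight s D S φ =
      liftRight s (orthProj S.right (Finset.univ.filter fun j => j.val < D)) φ := by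
  ext x
  rw [liftRight_apply, orthProj_apply]
  simp only [projRight, WithLp.ofLp_sum, Finset.sum_apply, PiLp.smul_apply, smul_eq_mul,
    PiLp.inner_apply, RCLike.inner_apply]
  refine Finset.sum_congr rfl fun j _ => ?_
  congr 1
  exact Finset.sum_congr rfl fun y _ => mul_comm _ _

theorem SchmidtDecomposition.eq_sum_tens {s : ℕ} {ψ : Chain n d}
    (S : SchmidtDecomposition (cutAmp s ψ)) :
    ψ = ∑ j, tens s ((S.coeff j : ℂ) • S.left j) (S.right j) :=
  (eq_sum_tens_iff s ψ _ _).2 S.expand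

theorem tens_zero_left (s : ℕ) (b : EuclideanSpace ℂ (RCfg n d s)) :
    tens s (0 : EuclideanSpace ℂ (LCfg n d s)) b = 0 := by
  ext x
  simp

theorem tens_zero_right (s : ℕ) (a : EuclideanSpace ℂ (LCfg n d s)) :
    tens s a (0 : EuclideanSpace ℂ (RCfg n d s)) = 0 := by
  ext x
  simp

theorem SchmidtDecomposition.projRight_self {s : ℕ} {ψ : Chain n d}
    (S : SchmidtDecomposition (cutAmp s ψ)) (D : ℕ) :
    projRight s D S ψ = ∑ j ∈ Finset.univ.filter (fun j : Fin S.rank => j.val < D),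
      tens s ((S.coeff j : ℂ) • S.left j) (S.right j) := by
  rw [projRight_eq]
  refine (congrArg _ S.eq_sum_tens).trans ?_
  rw [map_sum, Finset.sum_filter]
  refine Finset.sum_congr rfl fun j _ => ?_
  rw [liftRight_tens, orthProj_self S.right_orthonormal]
  by_cases h : j.val < D <;> simp [h, tens_zero_right]

/-- Both projections keep the first `D` Schmidt terms of `ψ`. This moves a projection to the other
side of its cut, but only when it acts on `ψ` itself. -/
theorem SchmidtDecomposition.projRight_self_eq_liftLeft {s : ℕ} {ψ : Chain n d}
    (S : SchmidtDecomposition (cutAmp s ψ)) (D : ℕ) :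
    projRight s D S ψ =
      liftLeft s (orthProj S.left (Finset.univ.filter fun j => j.val < D)) ψ := by
  rw [S.projRight_self]
  refine Eq.trans ?_ (congrArg _ S.eq_sum_tens).symm
  rw [map_sum, Finset.sum_filter]
  refine Finset.sum_congr rfl fun j _ => ?_
  rw [liftLeft_tens, map_smul, orthProj_self S.left_orthonormal]
  by_cases h : j.val < D <;> simp [h, tens_zero_left]

theorem SchmidtDecomposition.norm_sub_projRight_self {s : ℕ} {ψ : Chain n d}
    (S : SchmidtDecomposition (cutAmp s ψ)) (D : ℕ) :
    ‖ψ - projRight s D S ψ‖ ^ 2 = S.tail D ^ 2 := by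
  have h1 : ψ - projRight s D S ψ = ∑ j ∈ Finset.univ.filter (fun j : Fin S.rank => D ≤ j.val),
      tens s ((S.coeff j : ℂ) • S.left j) (S.right j) := by
    rw [S.projRight_self, sub_eq_iff_eq_add]
    conv_lhs => rw [S.eq_sum_tens]
    rw [add_comm, ← Finset.sum_filter_add_sum_filter_not Finset.univ
      (fun j : Fin S.rank => j.val < D)]
    simp only [not_lt]
  rw [h1, norm_sq_chain s, tail, Real.sq_sqrt (Finset.sum_nonneg fun _ _ => sq_nonneg _),
    ← S.sum_sq_coeff]
  simp

/-- Because of orthogonality, slice by slice, a further projection adds its own error in squares and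
does not enlarge the earlier one. -/
theorem norm_sub_projRight_sq_le {s : ℕ} {ψ : Chain n d} (S : SchmidtDecomposition (cutAmp s ψ))
    (D : ℕ) (φ : Chain n d) : ‖ψ - projRight s D S φ‖ ^ 2 ≤ S.tail D ^ 2 + ‖ψ - φ‖ ^ 2 := by
  rw [← S.norm_sub_projRight_self, projRight_eq, projRight_eq, norm_sq_eq_sum_sliceRight s,
    norm_sq_eq_sum_sliceRight s (ψ - _), norm_sq_eq_sum_sliceRight s (ψ - φ),
    ← Finset.sum_add_distrib]
  refine Finset.sum_le_sum fun a _ => ?_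
  simp only [sliceRight_sub, sliceRight_liftRight]
  rw [norm_sub_orthProj_sq S.right_orthonormal]
  have := norm_orthProj_apply_le S.right_orthonormal
    (Finset.univ.filter fun j : Fin S.rank => j.val < D) (sliceRight s a ψ - sliceRight s a φ)
  gcongr

/-! ### Truncation in canonical form -/

theorem foldl_finRange_induction {X : Type*} {m : ℕ} (f : X → Fin m → X) (x : X)
    (I : ℕ → X → Prop) (zero : I 0 x)
    (succ : ∀ (k : Fin m) (y : X), I k y → I (k + 1) (f y k)) :
    I m ((List.finRange m).foldl f x) := by
  induction m with
  | zero => simpa using zero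
  | succ m ih =>
    rw [List.finRange_succ_last, List.foldl_append, List.foldl_map]
    exact succ (Fin.last m) _ (ih (fun y k => f y k.castSucc) fun k y => succ k.castSucc y)

/-- Up to the cut `c`, the partly truncated vector is `W ψ` with `W` a contraction on the sites left
of the last cut treated. Later projections act right of `c`. -/
theorem cutNorm_truncate_le (D : ℕ) {ψ : Chain n d} (F : CanonicalForm ψ) (c : Fin (n - 1)) :
    cutNorm (c.val + 1) (truncate D F) ≤ cutNorm (c.val + 1) ψ := by
  have hone : ‖(1 : Op n d)‖ ≤ 1 := ContinuousLinearMap.norm_id_le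
  have hW : ∀ (k : ℕ) (W : Op n d), k ≤ c.val + 1 → ActsOn (leftSites n k) W → ‖W‖ ≤ 1 →
      cutNorm (c.val + 1) (W ψ) ≤ cutNorm (c.val + 1) ψ := by
    intro k W hk hW hW1
    refine (cutNorm_local_le (hW.mono (leftSites_mono hk)) (ActsOn.one _) ψ).trans ?_
    exact mul_le_of_le_one_left (cutNorm_nonneg _ _)
      (mul_le_one₀ hW1 (norm_nonneg _) hone)
  refine (foldl_finRange_induction _ _ (fun k y =>
    (k ≤ c.val → ∃ W : Op n d, ActsOn (leftSites n k) W ∧ ‖W‖ ≤ 1 ∧ y = W ψ) ∧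
    (c.val ≤ k → cutNorm (c.val + 1) y ≤ cutNorm (c.val + 1) ψ)) ?_ ?_).2 c.2.le
  · exact ⟨fun _ => ⟨1, ActsOn.one _, hone, rfl⟩, fun _ => le_rfl⟩
  · rintro k y ⟨h1, h2⟩
    have first : k.val + 1 ≤ c.val → ∃ W : Op n d, ActsOn (leftSites n (k.val + 1)) W ∧
        ‖W‖ ≤ 1 ∧ projRight (k.val + 1) D (F k) y = W ψ := by
      intro hk
      obtain ⟨W, hWa, hW1, rfl⟩ := h1 (by omega)
      have hWa' := hWa.mono (leftSites_mono k.val.le_succ)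
      refine ⟨_, hWa'.comp (actsOn_liftLeft _
        (orthProj (F k).left (Finset.univ.filter fun j => j.val < D))), ?_, ?_⟩
      · exact (norm_mul_le _ _).trans (mul_le_one₀ hW1 (norm_nonneg _)
          (norm_liftLeft_le _ _ (norm_orthProj_le (F k).left_orthonormal _)))
      -- Here `Q W ψ = W Q ψ = W P ψ`: the right projection `Q` commutes with `W`, reaches `ψ`, and
      -- turns into the left projection `P`.
      · rw [mul_apply_eq_comp, ← (F k).projRight_self_eq_liftLeft, projRight_eq,
          projRight_eq]
        exact (hWa'.apply_comm (actsOn_liftRight _ _) ψ).symm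
    refine ⟨first, fun hk => ?_⟩
    rcases hk.eq_or_lt with hk | hk
    · obtain ⟨W, hWa, hW1, hy⟩ := first hk.ge
      rw [hy]
      exact hW _ W (by omega) hWa hW1
    · refine le_trans ?_ (h2 (by omega))
      rw [projRight_eq]
      refine (cutNorm_local_le (ActsOn.one _) ((actsOn_liftRight _ _).mono
        (rightSites_anti (by omega))) y).trans ?_
      exact mul_le_of_le_one_left (cutNorm_nonneg _ _) (mul_le_one₀ hone (norm_nonneg _)
        (norm_liftRight_le _ _ (norm_orthProj_le (F k).right_orthonormal _)))

theorem norm_truncate_le (D : ℕ) {ψ : Chain n d} (F : CanonicalForm ψ) :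
    ‖truncate D F‖ ≤ ‖ψ‖ := by
  refine foldl_finRange_induction _ _ (fun _ y => ‖y‖ ≤ ‖ψ‖) le_rfl fun k y hy => ?_
  refine le_trans ?_ hy
  rw [projRight_eq]
  simpa using (liftRight (n := n) (d := d) _ _).le_of_opNorm_le
    (norm_liftRight_le _ _ (norm_orthProj_le (F k).right_orthonormal _)) y

/-- The squared error grows by at most `δ ^ 2` at each of the `n - 1` cuts. -/
theorem norm_sub_truncate_le (D : ℕ) {ψ : Chain n d} (F : CanonicalForm ψ) {δ : ℝ} (hδ : 0 ≤ δ)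
    (h : ∀ c, (F c).tail D ≤ δ) : ‖ψ - truncate D F‖ ≤ Real.sqrt n * δ := by
  have key : ‖ψ - truncate D F‖ ^ 2 ≤ ((n - 1 : ℕ) : ℝ) * δ ^ 2 := by
    refine foldl_finRange_induction _ _ (fun k y => ‖ψ - y‖ ^ 2 ≤ (k : ℝ) * δ ^ 2) (by simp)
      fun k y hy => ?_
    refine (norm_sub_projRight_sq_le (F k) D y).trans ?_
    have : (F k).tail D ^ 2 ≤ δ ^ 2 := pow_le_pow_left₀ (Real.sqrt_nonneg _) (h k) 2
    push_cast
    linarith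
  refine le_of_sq_le_sq (key.trans ?_) (by positivity)
  rw [mul_pow, Real.sq_sqrt (Nat.cast_nonneg n)]
  gcongr
  exact Nat.sub_le n 1

/-! ### Matrix product states -/

/-- A corner entry of the matrix product (open boundary) becomes a trace when a matrix unit is
absorbed into the first tensor; the scalar goes with it. -/
theorem isMPS_of_apply_eq {D : ℕ} (hD : 0 < D) (hn : 1 ≤ n) {ψ : Chain n d} (c : ℂ)
    (M : Fin n → Fin d → Matrix (Fin D) (Fin D) ℂ)
    (h : ∀ x, ψ x = c * (List.ofFn fun i => M i (x i)).prod ⟨0, hD⟩ ⟨0, hD⟩) : IsMPS D ψ := by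
  obtain ⟨n, rfl⟩ : ∃ m, n = m + 1 := ⟨n - 1, by omega⟩
  refine ⟨Function.update M 0 fun a => Matrix.single ⟨0, hD⟩ ⟨0, hD⟩ c * M 0 a, fun x => ?_⟩
  rw [h, List.ofFn_succ, List.ofFn_succ, List.prod_cons, List.prod_cons]
  simp only [Function.update_self, ne_eq, Fin.succ_ne_zero, not_false_eq_true,
    Function.update_of_ne]
  rw [mul_assoc, Matrix.trace_single_mul, smul_eq_mul]

theorem IsMPS.smul {D : ℕ} (hn : 1 ≤ n) {ψ : Chain n d} (h : IsMPS D ψ) (c : ℂ) :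
    IsMPS D (c • ψ) := by
  obtain ⟨n, rfl⟩ : ∃ m, n = m + 1 := ⟨n - 1, by omega⟩
  obtain ⟨M, hM⟩ := h
  refine ⟨Function.update M 0 fun a => c • M 0 a, fun x => ?_⟩
  rw [PiLp.smul_apply, hM, List.ofFn_succ, List.ofFn_succ, List.prod_cons, List.prod_cons]
  simp [Matrix.trace_smul]

theorem IsProductState.isMPS {D : ℕ} (hD : 0 < D) (hn : 1 ≤ n) {ψ : Chain n d}
    (h : IsProductState ψ) : IsMPS D ψ := by
  obtain ⟨u, -, hu⟩ := h
  refine isMPS_of_apply_eq hD hn 1 (fun i a => Matrix.diagonal fun _ => u i a) fun x => ?_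
  have : ∀ l : List ℂ, (l.map fun c => Matrix.diagonal fun _ : Fin D => c).prod =
      Matrix.diagonal fun _ => l.prod := by
    intro l
    induction l with
    | nil => simp
    | cons a l ih => simp [ih]
  have h2 := this (List.ofFn fun i => u i (x i))
  rw [List.map_ofFn] at h2
  rw [hu, one_mul]
  erw [h2]
  simp [List.prod_ofFn]

/-- The product of the matrices of the first `k` sites. -/
noncomputable def mpsProd {D : ℕ} (M : Fin n → Fin d → Matrix (Fin D) (Fin D) ℂ) (k : ℕ)
    (x : Cfg n d) : Matrix (Fin D) (Fin D) ℂ :=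
  ((List.ofFn fun i => M i (x i)).take k).prod

theorem mpsProd_congr {D : ℕ} {M M' : Fin n → Fin d → Matrix (Fin D) (Fin D) ℂ} {k : ℕ}
    {x x' : Cfg n d} (h : ∀ i : Fin n, i.val < k → M i (x i) = M' i (x' i)) :
    mpsProd M k x = mpsProd M' k x' := by
  rw [mpsProd, mpsProd]
  congr 1
  refine List.ext_getElem (by simp) fun i h1 h2 => ?_
  simp only [List.getElem_take, List.getElem_ofFn]
  refine h _ ?_
  simp at h1
  exact h1.1

theorem mpsProd_succ {D : ℕ} (M : Fin n → Fin d → Matrix (Fin D) (Fin D) ℂ) {k : ℕ} (hk : k < n)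
    (x : Cfg n d) : mpsProd M (k + 1) x = mpsProd M k x * M ⟨k, hk⟩ (x ⟨k, hk⟩) := by
  rw [mpsProd, List.take_add_one, List.prod_append, mpsProd]
  simp [hk]

theorem mpsProd_update_succ {D : ℕ} (M : Fin n → Fin d → Matrix (Fin D) (Fin D) ℂ) {k : ℕ}
    (hk : k < n) (N : Fin d → Matrix (Fin D) (Fin D) ℂ) (x : Cfg n d) :
    mpsProd (Function.update M ⟨k, hk⟩ N) (k + 1) x = mpsProd M k x * N (x ⟨k, hk⟩) := by
  rw [mpsProd_succ _ hk, Function.update_self]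
  congr 1
  refine mpsProd_congr fun i hi => ?_
  rw [Function.update_of_ne]
  rintro rfl
  exact lt_irrefl _ hi

/-- Pads the bond index with zeros to exactly `D` values when the Schmidt rank is smaller. -/
theorem sum_filter_val_lt {r : ℕ} (D : ℕ) (f : Fin r → ℂ) :
    ∑ j ∈ Finset.univ.filter (fun j : Fin r => j.val < D), f j =
      ∑ j : Fin D, if h : j.val < r then f ⟨j, h⟩ else 0 := by
  rw [Fin.sum_univ_eq_sum_range (fun m => if h : m < r then f ⟨m, h⟩ else 0) D, Finset.sum_filter]
  have : ∀ j : Fin r, (if j.val < D then f j else 0) =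
      (fun m => if m < D then (if h : m < r then f ⟨m, h⟩ else 0) else 0) j.val := by
    intro j
    simp
  simp_rw [this]
  rw [Fin.sum_univ_eq_sum_range (fun m => if m < D then (if h : m < r then f ⟨m, h⟩ else 0) else 0),
    ← Finset.sum_filter]
  refine Finset.sum_subset_zero_on_sdiff (fun m hm => ?_) (fun m hm => ?_) fun _ _ => rfl
  · simp at hm ⊢
    exact hm.2
  · simp at hm
    rw [dif_neg]
    intro h
    exact absurd hm.1 (by simpa using hm.2 h)

/-- After `k` projections the vector is a row of `k` matrices contracted with `D` vectors on the
remaining sites. The next projection splits off one more site: its tensor holds the overlaps of the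
new right Schmidt vectors with the old vectors, and those Schmidt vectors are the new remainder. -/
theorem isMPS_truncate {D : ℕ} (hD : 0 < D) (hn : 1 ≤ n) {ψ : Chain n d} (F : CanonicalForm ψ) :
    IsMPS D (truncate D F) := by
  have key : ∃ (M : Fin n → Fin d → Matrix (Fin D) (Fin D) ℂ) (r : Fin D → RCfg n d (n - 1) → ℂ),
      ∀ x, truncate D F x = ∑ j, mpsProd M (n - 1) x ⟨0, hD⟩ j * r j (rpart (n - 1) x) := by
    refine foldl_finRange_induction
      (fun φ (c : Fin (n - 1)) => projRight (c.val + 1) D (F c) φ) ψ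
      (fun k y => ∃ (M : Fin n → Fin d → Matrix (Fin D) (Fin D) ℂ) (r : Fin D → RCfg n d k → ℂ),
        ∀ x, y x = ∑ j, mpsProd M k x ⟨0, hD⟩ j * r j (rpart k x)) ?_ ?_
    -- Before any projection the product is empty, and `ψ` itself sits at bond value `0`.
    · refine ⟨fun _ _ => 1, fun j b => if j = ⟨0, hD⟩ then
        ψ (fun i => b ⟨i, by simp⟩) else 0, fun x => ?_⟩
      simp [mpsProd, rpart]
    · rintro k y ⟨M, r, hM⟩
      have hk : k.val < n := by omega
      -- Prepends the value at site `k` to a configuration of the sites after it.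
      let e : Fin d → RCfg n d (k.val + 1) → RCfg n d k.val := fun a w i =>
        if h : i.1.val < k.val + 1 then a else w ⟨i.1, h⟩
      refine ⟨Function.update M ⟨k.val, hk⟩ fun a => Matrix.of fun j j' =>
        if h : j'.val < (F k).rank then ∑ w, star ((F k).right ⟨j', h⟩ w) * r j (e a w) else 0,
        fun j' b => if h : j'.val < (F k).rank then (F k).right ⟨j', h⟩ b else 0, fun x => ?_⟩
      have hx : ∀ w, y (glue (k.val + 1) (lpart (k.val + 1) x) w) =
          ∑ j, mpsProd M k x ⟨0, hD⟩ j * r j (e (x ⟨k, hk⟩) w) := by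
        intro w
        rw [hM]
        have e1 : mpsProd M k (glue (k.val + 1) (lpart (k.val + 1) x) w) = mpsProd M k x :=
          mpsProd_congr fun i hi => by
            simp [glue, lpart, show i.val < k.val + 1 by omega]
        have e2 : rpart k (glue (k.val + 1) (lpart (k.val + 1) x) w) = e (x ⟨k, hk⟩) w := by
          funext i
          simp only [rpart, glue, lpart, e]
          split_ifs with h
          · congr 1
            exact Fin.ext (by have := i.2; simp; omega)
          · rfl
        rw [e1, e2]
      simp only [projRight, sum_filter_val_lt]
      refine Finset.sum_congr rfl fun j' _ => ?_
      rw [mpsProd_update_succ, Matrix.mul_apply]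
      by_cases h : j'.val < (F k).rank
      · simp only [h, dif_pos, hx, Matrix.of_apply]
        congr 1
        simp_rw [Finset.mul_sum]
        rw [Finset.sum_comm]
        exact Finset.sum_congr rfl fun j _ => Finset.sum_congr rfl fun w _ => by ring
      · simp [h]
  obtain ⟨M, r, hM⟩ := key
  have hk : n - 1 < n := by omega
  -- Only the last site remains, and its vectors become the last tensor; all columns are equal,
  -- since only column `0` is read.
  refine isMPS_of_apply_eq hD hn 1 (Function.update M ⟨n - 1, hk⟩ fun a =>
    Matrix.of fun j _ => r j fun _ => a) fun x => ?_
  have h1 := mpsProd_update_succ M hk (fun a => Matrix.of fun j _ => r j fun _ => a) x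
  rw [mpsProd, Nat.sub_add_cancel hn, List.take_of_length_le (by simp)] at h1
  rw [h1, one_mul, Matrix.mul_apply]
  refine (hM x).trans (Finset.sum_congr rfl fun j _ => ?_)
  congr 2
  funext i
  have : i.1 = ⟨n - 1, hk⟩ := Fin.ext (by have := i.2; have := i.1.2; simp; omega)
  simp [rpart, this]

/-! ### Splitting the Hamiltonian at a cut -/

theorem isSelfAdjoint_sum_op {E ι : Type*} [NormedAddCommGroup E] [InnerProductSpace ℂ E]
    [CompleteSpace E] (F : Finset ι) (A : ι → E →L[ℂ] E) (h : ∀ i, IsSelfAdjoint (A i)) :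
    IsSelfAdjoint (∑ i ∈ F, A i) :=
  isSelfAdjoint_sum F fun i _ => h i

namespace Interaction

/-- Every term in `F` is counted at least once when the one-site energies are summed over `W`. -/
theorem OneSiteEnergyLE.sum_norm_le {H : Interaction n d} {g : ℝ} (hg : H.OneSiteEnergyLE g)
    (W : Finset (Fin n)) (F : Finset (Finset (Fin n))) (hF : ∀ Z ∈ F, ∃ i ∈ Z, i ∈ W) :
    ∑ Z ∈ F, ‖H.term Z‖ ≤ W.card * g := by
  calc ∑ Z ∈ F, ‖H.term Z‖
      ≤ ∑ Z ∈ F, ∑ i ∈ W, if i ∈ Z then ‖H.term Z‖ else 0 := by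
        refine Finset.sum_le_sum fun Z hZ => ?_
        obtain ⟨i, hi, hiW⟩ := hF Z hZ
        refine le_trans ?_ (Finset.single_le_sum (f := fun i => if i ∈ Z then ‖H.term Z‖ else 0)
          (fun j _ => by positivity) hiW)
        simp [hi]
    _ = ∑ i ∈ W, ∑ Z ∈ F, if i ∈ Z then ‖H.term Z‖ else 0 := Finset.sum_comm
    _ ≤ ∑ i ∈ W, g := by
        refine Finset.sum_le_sum fun i _ => le_trans ?_ (hg i)
        rw [Finset.sum_filter]
        exact Finset.sum_le_sum_of_subset_of_nonneg (Finset.subset_univ _)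
          fun Z _ _ => by positivity
    _ = W.card * g := by simp

/-- The terms that act nontrivially only on the sites in `W`. -/
noncomputable def inside (H : Interaction n d) (W : Finset (Fin n)) : Op n d :=
  ∑ Z ∈ Finset.univ.filter (fun Z : Finset (Fin n) => Z.Nonempty ∧ Z ⊆ W), H.term Z

theorem actsOn_inside (H : Interaction n d) (W : Finset (Fin n)) : ActsOn W (H.inside W) :=
  ActsOn.sum fun Z hZ => (H.term_supported Z).actsOn.mono (Finset.mem_filter.1 hZ).2.2

theorem isSelfAdjoint_sum_term (H : Interaction n d) (F : Finset (Finset (Fin n))) :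
    IsSelfAdjoint (∑ Z ∈ F, H.term Z) :=
  isSelfAdjoint_sum_op F H.term H.term_selfAdjoint

theorem norm_inside_le {H : Interaction n d} {g : ℝ} (hg : H.OneSiteEnergyLE g)
    (W : Finset (Fin n)) : ‖H.inside W‖ ≤ W.card * g := by
  refine (norm_sum_le _ _).trans (hg.sum_norm_le W _ fun Z hZ => ?_)
  obtain ⟨⟨i, hi⟩, hZW⟩ := (Finset.mem_filter.1 hZ).2
  exact ⟨i, hi, hZW hi⟩

theorem norm_ham_le {H : Interaction n d} {g : ℝ} (hg : H.OneSiteEnergyLE g) :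
    ‖H.ham‖ ≤ g * n := by
  have h : H.ham = H.inside Finset.univ := by
    rw [ham, inside, Finset.sum_filter]
    refine Finset.sum_congr rfl fun Z _ => ?_
    rcases Z.eq_empty_or_nonempty with rfl | hZ
    · simp [H.term_empty]
    · simp [hZ]
  have := norm_inside_le hg Finset.univ
  rw [h, mul_comm]
  simpa using this

theorem ham_eq (H : Interaction n d) (s : ℕ) :
    H.ham = H.inside (leftSites n s) + H.inside (rightSites n s) + H.boundary s := by
  rw [ham, inside, inside, boundary, Finset.sum_filter, Finset.sum_filter, Finset.sum_filter,
    ← Finset.sum_add_distrib, ← Finset.sum_add_distrib]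
  refine Finset.sum_congr rfl fun Z _ => ?_
  rcases Z.eq_empty_or_nonempty with rfl | ⟨i, hi⟩
  · simp [H.term_empty]
  have hne : Z.Nonempty := ⟨i, hi⟩
  by_cases hA : Z ⊆ leftSites n s
  · have hB : ¬ Z ⊆ rightSites n s := fun h => mem_rightSites.1 (h hi) (mem_leftSites.1 (hA hi))
    have hV : ¬ ∃ i ∈ Z, ¬ i.val < s := by
      rintro ⟨j, hj, hjs⟩
      exact hjs (mem_leftSites.1 (hA hj))
    rw [if_pos ⟨hne, hA⟩, if_neg (fun h => hB h.2), if_neg (fun h => hV h.2)]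
    simp
  · obtain ⟨j, hj, hjs⟩ := Finset.not_subset.1 hA
    rw [mem_leftSites] at hjs
    by_cases hB : Z ⊆ rightSites n s
    · have hV : ¬ ∃ i ∈ Z, i.val < s := by
        rintro ⟨k, hk, hks⟩
        exact mem_rightSites.1 (hB hk) hks
      rw [if_neg (fun h => hA h.2), if_pos ⟨hne, hB⟩, if_neg (fun h => hV h.1)]
      simp
    · obtain ⟨k, hk, hks⟩ := Finset.not_subset.1 hB
      rw [mem_rightSites, not_not] at hks
      have hV : (∃ i ∈ Z, i.val < s) ∧ ∃ i ∈ Z, ¬ i.val < s := ⟨⟨k, hk, hks⟩, ⟨j, hj, hjs⟩⟩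
      rw [if_neg (fun h => hA h.2), if_neg (fun h => hB h.2), if_pos hV]
      simp

end Interaction

theorem card_leftSites_add_card_rightSites (n s : ℕ) :
    (leftSites n s).card + (rightSites n s).card = n := by
  rw [leftSites, rightSites, Finset.card_filter_add_card_filter_not]
  simp

/-- Since `⟨v, O v⟩` is real, the cross term of `v` and `iτ O v` has real part zero, so the
deviation is quadratic in `τ`. -/
theorem norm_one_sub_smul_sq_le {O : Op n d} (hO : IsSelfAdjoint O) (τ : ℝ) {a : ℝ}
    (ha : ‖O‖ ≤ a) :
    ‖1 - (Complex.I * (τ : ℂ)) • O‖ ^ 2 ≤ 1 + τ ^ 2 * a ^ 2 := by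
  have h0 : 0 ≤ 1 + τ ^ 2 * a ^ 2 := by positivity
  rw [← Real.le_sqrt (norm_nonneg _) h0]
  refine ContinuousLinearMap.opNorm_le_bound _ (Real.sqrt_nonneg _) fun v => ?_
  refine le_of_sq_le_sq ?_ (by positivity)
  rw [mul_pow, Real.sq_sqrt h0]
  have h1 : (1 - (Complex.I * (τ : ℂ)) • O) v = v - (Complex.I * (τ : ℂ)) • O v := rfl
  have h2 : (starRingEnd ℂ) (inner ℂ v (O v)) = inner ℂ v (O v) := by
    rw [inner_conj_symm]
    exact (ContinuousLinearMap.isSelfAdjoint_iff_isSymmetric.1 hO) v v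
  have h3 : (inner ℂ v (O v)).im = 0 := Complex.conj_eq_iff_im.1 h2
  have h4 : ‖O v‖ ≤ a * ‖v‖ := O.le_of_opNorm_le ha v
  rw [h1, norm_sub_sq (𝕜 := ℂ), inner_smul_right, norm_smul]
  have h5 : RCLike.re (Complex.I * (τ : ℂ) * inner ℂ v (O v)) = 0 := by
    simp [h3]
  have h6 : ‖Complex.I * (τ : ℂ)‖ ^ 2 = τ ^ 2 := by simp
  rw [h5, mul_pow, h6]
  have h7 := pow_le_pow_left₀ (norm_nonneg _) h4 2
  nlinarith [mul_le_mul_of_nonneg_left h7 (sq_nonneg τ)]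

/-- Ancillas of dimension one are enough to bound the strength from below. -/
theorem cutNorm_apply_tens_le_of_seStrength_le {s : ℕ} {O : Op n d} {J : ℝ≥0}
    (h : seStrength s O ≤ J) (a : EuclideanSpace ℂ (LCfg n d s))
    (b : EuclideanSpace ℂ (RCfg n d s)) (ha : ‖a‖ = 1) (hb : ‖b‖ = 1) :
    cutNorm s (O (tens s a b)) ≤ J := by
  let φ : EuclideanSpace ℂ (LCfg n d s × Fin 1) := WithLp.toLp 2 fun x => a x.1
  let χ : EuclideanSpace ℂ (RCfg n d s × Fin 1) := WithLp.toLp 2 fun x => b x.1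
  have hφ : ‖φ‖ = 1 := by
    rw [← ha, EuclideanSpace.norm_eq, EuclideanSpace.norm_eq, Fintype.sum_prod_type]
    simp [φ]
  have hχ : ‖χ‖ = 1 := by
    rw [← hb, EuclideanSpace.norm_eq, EuclideanSpace.norm_eq, Fintype.sum_prod_type]
    simp [χ]
  obtain ⟨S⟩ := SchmidtDecomposition.exists_schmidtDecomposition (ancillaAmp s O φ χ)
  have hS : ENNReal.ofReal S.sum ≤ J := by
    refine le_trans ?_ h
    rw [seStrength]
    refine le_iSup_of_le 1 (le_iSup_of_le 1 (le_iSup_of_le φ (le_iSup_of_le χ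
      (le_iSup_of_le hφ (le_iSup_of_le hχ (le_iSup_of_le S le_rfl))))))
  have hS' : S.sum ≤ J := by
    rw [← ENNReal.ofReal_coe_nnreal] at hS
    exact (ENNReal.ofReal_le_ofReal_iff J.2).1 hS
  refine le_trans (nuclearNorm_le (fun j => WithLp.toLp 2 fun x => (S.coeff j : ℂ) * S.left j (x, 0))
    (fun j => WithLp.toLp 2 fun y => S.right j (y, 0)) (fun x y => S.expand (x, 0) (y, 0))) ?_
  refine le_trans (le_of_eq ?_) hS'
  rw [← S.sum_mul_norm]
  refine Finset.sum_congr rfl fun j _ => ?_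
  congr 1
  · rw [EuclideanSpace.norm_eq, EuclideanSpace.norm_eq, Fintype.sum_prod_type]
    simp
  · rw [EuclideanSpace.norm_eq, EuclideanSpace.norm_eq, Fintype.sum_prod_type]
    simp

theorem cutNorm_apply_le_of_seStrength_le {s : ℕ} {O : Op n d} {J : ℝ≥0}
    (h : seStrength s O ≤ J) (ψ : Chain n d) : cutNorm s (O ψ) ≤ J * cutNorm s ψ := by
  obtain ⟨r, a, b, h1, h2⟩ := exists_cut_decomposition s ψ
  have key : ∀ k, cutNorm s (O (tens s (a k) (b k))) ≤ J * (‖a k‖ * ‖b k‖) := by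
    intro k
    by_cases ha : a k = 0
    · have := cutNorm_tens_le s (0 : EuclideanSpace ℂ (LCfg n d s)) (b k)
      rw [ha, tens_zero_left, map_zero]
      simpa [tens_zero_left] using this
    by_cases hb : b k = 0
    · have := cutNorm_tens_le s (a k) (0 : EuclideanSpace ℂ (RCfg n d s))
      rw [hb, tens_zero_right, map_zero]
      simpa [tens_zero_right] using this
    have ha' : ‖a k‖ ≠ 0 := norm_ne_zero_iff.2 ha
    have hb' : ‖b k‖ ≠ 0 := norm_ne_zero_iff.2 hb
    have e : tens s (a k) (b k) = ((‖a k‖ * ‖b k‖ : ℝ) : ℂ) •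
        tens s (((‖a k‖⁻¹ : ℝ) : ℂ) • a k) (((‖b k‖⁻¹ : ℝ) : ℂ) • b k) := by
      ext x
      have ha'' : ((‖a k‖ : ℝ) : ℂ) ≠ 0 := by exact_mod_cast ha'
      have hb'' : ((‖b k‖ : ℝ) : ℂ) ≠ 0 := by exact_mod_cast hb'
      simp only [PiLp.smul_apply, tens_apply, smul_eq_mul]
      push_cast
      field_simp
    have hu := cutNorm_apply_tens_le_of_seStrength_le h
      (((‖a k‖⁻¹ : ℝ) : ℂ) • a k) (((‖b k‖⁻¹ : ℝ) : ℂ) • b k)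
      (by rw [norm_smul, Complex.norm_real]; simp [ha']) (by rw [norm_smul, Complex.norm_real]; simp [hb'])
    rw [e, map_smul]
    refine (cutNorm_smul_le _ _ _).trans ?_
    rw [Complex.norm_real, Real.norm_of_nonneg (by positivity), mul_comm]
    exact mul_le_mul_of_nonneg_right hu (by positivity)
  rw [← h2, Finset.mul_sum]
  conv_lhs => rw [h1, map_sum]
  exact (cutNorm_sum_le _ s _).trans (Finset.sum_le_sum fun k _ => key k)

/-- With `a`, `b` the norm bounds of the two sides, the quadratic contributions are `τ²(a² + b²)/2`
from the product of local factors and `τ²ab` from its correction. They add up to `τ²(a + b)²/2`,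
where `a + b = gn`. -/
theorem cutNorm_eulerStep_le {H : Interaction n d} {g : ℝ} (hg : H.OneSiteEnergyLE g) {τ : ℝ}
    (hτ : 0 ≤ τ) {s : ℕ} {J : ℝ≥0} (h : seStrength s (H.boundary s) ≤ J) (ψ : Chain n d) :
    cutNorm s (eulerStep H τ ψ) ≤ (1 + (J * τ + (g * n * τ) ^ 2 / 2)) * cutNorm s ψ := by
  set A := H.inside (leftSites n s) with hA
  set B := H.inside (rightSites n s) with hB
  set z : ℂ := Complex.I * (τ : ℂ) with hz
  have hAa : ActsOn (leftSites n s) A := H.actsOn_inside _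
  have hBa : ActsOn (rightSites n s) B := H.actsOn_inside _
  -- The correction has sign `+τ²` because the product of local factors contains `z² A B = -τ² A B`.
  have e : eulerStep H τ ψ = (1 - z • A) ((1 - z • B) ψ) +
      (((τ : ℂ) ^ 2) • A (B ψ) + (-z) • H.boundary s ψ) := by
    have hz2 : z * z = -(τ : ℂ) ^ 2 := by
      rw [hz]; linear_combination (τ : ℂ) ^ 2 * Complex.I_mul_I
    have h1 : (1 - z • A) ((1 - z • B) ψ) =
        ψ - z • B ψ - z • A ψ + (z * z) • A (B ψ) := by
      simp only [sub_apply, one_apply_eq_self, smul_apply, map_sub, map_smul, smul_sub, smul_smul]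
      abel
    rw [h1, hz2, eulerStep, H.ham_eq s]
    simp only [add_apply, smul_add, neg_smul]
    abel
  set a : ℝ := (leftSites n s).card * g with ha
  set b : ℝ := (rightSites n s).card * g with hb
  have hAn : ‖A‖ ≤ a := Interaction.norm_inside_le hg _
  have hBn : ‖B‖ ≤ b := Interaction.norm_inside_le hg _
  have hab : a + b = g * n := by
    rw [ha, hb, ← add_mul, mul_comm]
    exact_mod_cast congrArg (fun m : ℕ => g * (m : ℝ)) (card_leftSites_add_card_rightSites n s)
  have h0 := cutNorm_nonneg s ψ
  have t1 : cutNorm s ((1 - z • A) ((1 - z • B) ψ)) ≤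
      (1 + τ ^ 2 * (a ^ 2 + b ^ 2) / 2) * cutNorm s ψ := by
    refine (cutNorm_local_le ((ActsOn.one _).sub (hAa.smul z)) ((ActsOn.one _).sub (hBa.smul z))
      ψ).trans (mul_le_mul_of_nonneg_right ?_ h0)
    have h1 : ‖1 - z • A‖ ^ 2 ≤ _ := norm_one_sub_smul_sq_le (H.isSelfAdjoint_sum_term _ : IsSelfAdjoint A) τ hAn
    have h2 : ‖1 - z • B‖ ^ 2 ≤ _ := norm_one_sub_smul_sq_le (H.isSelfAdjoint_sum_term _ : IsSelfAdjoint B) τ hBn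
    nlinarith [sq_nonneg (‖1 - z • A‖ - ‖1 - z • B‖)]
  have t2 : cutNorm s (((τ : ℂ) ^ 2) • A (B ψ)) ≤ τ ^ 2 * (a * b) * cutNorm s ψ := by
    refine (cutNorm_smul_le _ _ _).trans ?_
    rw [norm_pow, Complex.norm_real, Real.norm_of_nonneg hτ, mul_assoc (τ ^ 2)]
    refine mul_le_mul_of_nonneg_left ((cutNorm_local_le hAa hBa ψ).trans ?_) (sq_nonneg τ)
    exact mul_le_mul_of_nonneg_right
      (mul_le_mul hAn hBn (norm_nonneg _) ((norm_nonneg _).trans hAn)) h0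
  have t3 : cutNorm s ((-z) • H.boundary s ψ) ≤ τ * (J * cutNorm s ψ) := by
    refine (cutNorm_smul_le _ _ _).trans ?_
    have : ‖-z‖ = τ := by simp [hz, abs_of_nonneg hτ]
    rw [this]
    exact mul_le_mul_of_nonneg_left (cutNorm_apply_le_of_seStrength_le h ψ) hτ
  rw [e]
  refine (cutNorm_add_le _ _ _).trans ((add_le_add t1 ((cutNorm_add_le _ _ _).trans
    (add_le_add t2 t3))).trans (le_of_eq ?_))
  rw [← hab]
  ring

/-! ### Product states -/

theorem norm_prod_eq_one {ι : Type} [Fintype ι] [DecidableEq ι] (u : ι → EuclideanSpace ℂ (Fin d))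
    (hu : ∀ i, ‖u i‖ = 1) :
    ‖(WithLp.toLp 2 fun x : ι → Fin d => ∏ i, u i (x i) : EuclideanSpace ℂ (ι → Fin d))‖ = 1 := by
  rw [← sq_eq_sq₀ (norm_nonneg _) zero_le_one, EuclideanSpace.norm_sq_eq]
  simp only [norm_prod, ← Finset.prod_pow]
  rw [← Fintype.piFinset_univ, ← Finset.prod_univ_sum (fun _ => Finset.univ)
    (fun i a => ‖u i a‖ ^ 2)]
  simp_rw [← EuclideanSpace.norm_sq_eq, hu]
  simp

theorem IsProductState.norm_eq_one {ψ : Chain n d} (h : IsProductState ψ) : ‖ψ‖ = 1 := by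
  obtain ⟨u, hu, hψ⟩ := h
  rw [← norm_prod_eq_one u hu]
  congr 1
  ext x
  exact hψ x

theorem IsProductState.cutNorm_le_one {ψ : Chain n d} (h : IsProductState ψ) (s : ℕ) :
    cutNorm s ψ ≤ 1 := by
  obtain ⟨u, hu, hψ⟩ := h
  have e : ψ = tens s
      (WithLp.toLp 2 fun x : LCfg n d s => ∏ i : {i : Fin n // i.val < s}, u i.1 (x i))
      (WithLp.toLp 2 fun x : RCfg n d s => ∏ i : {i : Fin n // ¬ i.val < s}, u i.1 (x i)) := by
    ext x
    rw [hψ, ← Fintype.prod_subtype_mul_prod_subtype (fun i : Fin n => i.val < s)]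
    rfl
  rw [e]
  refine (cutNorm_tens_le s _ _).trans (le_of_eq ?_)
  rw [norm_prod_eq_one (fun i : {i : Fin n // i.val < s} => u i.1) fun i => hu i.1,
    norm_prod_eq_one (fun i : {i : Fin n // ¬ i.val < s} => u i.1) fun i => hu i.1, one_mul]

/-! ### Rescaling -/

theorem clip_eq (φ : Chain n d) : clip φ = (((max 1 ‖φ‖)⁻¹ : ℝ) : ℂ) • φ := by
  rw [clip, Complex.coe_smul]

theorem norm_clip_le (φ : Chain n d) : ‖clip φ‖ ≤ 1 := by
  have h : 0 < max 1 ‖φ‖ := lt_max_of_lt_left one_pos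
  rw [clip, norm_smul, Real.norm_of_nonneg (by positivity), inv_mul_le_iff₀ h, mul_one]
  exact le_max_right _ _

theorem cutNorm_clip_le (s : ℕ) (φ : Chain n d) : cutNorm s (clip φ) ≤ cutNorm s φ := by
  have h : 1 ≤ max 1 ‖φ‖ := le_max_left _ _
  rw [clip_eq]
  refine (cutNorm_smul_le _ _ _).trans (mul_le_of_le_one_left (cutNorm_nonneg _ _) ?_)
  rw [Complex.norm_real, Real.norm_of_nonneg (by positivity)]
  exact inv_le_one_of_one_le₀ h

/-- Radial projection onto the unit ball does not move a point away from any point of the ball; for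
`‖φ‖ ≥ 1` this rests on `re ⟨ψ, φ⟩ ≤ ‖φ‖`. -/
theorem norm_sub_clip_le {ψ : Chain n d} (hψ : ‖ψ‖ ≤ 1) (φ : Chain n d) :
    ‖ψ - clip φ‖ ≤ ‖ψ - φ‖ := by
  rcases le_total ‖φ‖ 1 with h | h
  · rw [clip, max_eq_left h]
    simp
  · refine le_of_sq_le_sq ?_ (norm_nonneg _)
    have h0 : 0 < ‖φ‖ := one_pos.trans_le h
    set c : ℝ := ‖φ‖⁻¹ with hc
    have hcφ : c * ‖φ‖ = 1 := inv_mul_cancel₀ h0.ne'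
    have hc1 : c ≤ 1 := inv_le_one_of_one_le₀ h
    have hc0 : 0 ≤ c := by positivity
    rw [clip_eq, max_eq_right h, norm_sub_sq (𝕜 := ℂ), norm_sub_sq (𝕜 := ℂ), inner_smul_right,
      norm_smul, Complex.norm_real, Real.norm_of_nonneg hc0, hcφ]
    have hre : RCLike.re ((c : ℂ) * inner ℂ ψ φ) = c * RCLike.re (inner ℂ ψ φ) :=
      RCLike.re_ofReal_mul c _
    rw [hre]
    have hle : RCLike.re (inner ℂ ψ φ) ≤ ‖φ‖ :=
      (re_inner_le_norm ψ φ).trans (mul_le_of_le_one_left h0.le hψ)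
    nlinarith [mul_le_mul_of_nonneg_left hle (sub_nonneg.2 hc1), sq_nonneg (‖φ‖ - 1)]

/-! ### The exact evolution -/

theorem Interaction.isSelfAdjoint_ham (H : Interaction n d) : IsSelfAdjoint H.ham :=
  H.isSelfAdjoint_sum_term _

section propagator

variable {E : Type*} [NormedAddCommGroup E] [InnerProductSpace ℂ E] [CompleteSpace E]

theorem neg_I_smul_mem_skewAdjoint {A : E →L[ℂ] E} (hA : IsSelfAdjoint A) (t : ℝ) :
    (-(Complex.I * (t : ℂ))) • A ∈ skewAdjoint (E →L[ℂ] E) := by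
  rw [skewAdjoint.mem_iff, star_smul, hA.star_eq]
  simp

theorem exp_mem_unitary {A : E →L[ℂ] E} (hA : A ∈ skewAdjoint (E →L[ℂ] E)) :
    NormedSpace.exp A ∈ unitary (E →L[ℂ] E) := by
  let +nondep : NormedAlgebra ℚ (E →L[ℂ] E) := .restrictScalars ℚ ℂ _
  exact NormedSpace.exp_mem_unitary_of_mem_skewAdjoint hA

theorem norm_exp_smul_apply {A : E →L[ℂ] E} (hA : IsSelfAdjoint A) (t : ℝ) (v : E) :
    ‖NormedSpace.exp ((-(Complex.I * (t : ℂ))) • A) v‖ = ‖v‖ :=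
  ContinuousLinearMap.norm_map_of_mem_unitary
    (exp_mem_unitary (neg_I_smul_mem_skewAdjoint hA t)) v

theorem exp_zero_smul_apply (A : E →L[ℂ] E) (v : E) :
    NormedSpace.exp ((-(Complex.I * ((0 : ℝ) : ℂ))) • A) v = v := by
  let +nondep : NormedAlgebra ℚ (E →L[ℂ] E) := .restrictScalars ℚ ℂ _
  simp

theorem exp_add_smul_apply (A : E →L[ℂ] E) (s t : ℝ) (v : E) :
    NormedSpace.exp ((-(Complex.I * ((s + t : ℝ) : ℂ))) • A) v =
      NormedSpace.exp ((-(Complex.I * (s : ℂ))) • A)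
        (NormedSpace.exp ((-(Complex.I * (t : ℂ))) • A) v) := by
  let +nondep : NormedAlgebra ℚ (E →L[ℂ] E) := .restrictScalars ℚ ℂ _
  have hc : Commute ((-(Complex.I * (s : ℂ))) • A) ((-(Complex.I * (t : ℂ))) • A) :=
    ((Commute.refl _).smul_left _).smul_right _
  have e : (-(Complex.I * ((s + t : ℝ) : ℂ))) • A =
      (-(Complex.I * (s : ℂ))) • A + (-(Complex.I * (t : ℂ))) • A := by
    rw [← add_smul]
    congr 1
    push_cast
    ring
  rw [e, NormedSpace.exp_add_of_commute hc, mul_apply_eq_comp]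

theorem hasDerivAt_exp_smul_apply (A : E →L[ℂ] E) (v : E) (t : ℝ) :
    HasDerivAt (fun t : ℝ => NormedSpace.exp ((-(Complex.I * (t : ℂ))) • A) v)
      (-(Complex.I • A (NormedSpace.exp ((-(Complex.I * (t : ℂ))) • A) v))) t := by
  have h := hasDerivAt_exp_smul_const' (𝕂 := ℝ) ((-Complex.I) • A) t
  have e : ∀ t : ℝ, t • ((-Complex.I) • A) = (-(Complex.I * (t : ℂ))) • A := by
    intro t
    rw [← Complex.coe_smul, smul_smul]
    congr 1
    ring
  simp_rw [e] at h
  have h2 := ((ContinuousLinearMap.apply ℂ E v).restrictScalars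
    ℝ).hasFDerivAt.comp_hasDerivAt t h
  convert! h2 using 1
  simp

end propagator

theorem norm_evolve (H : Interaction n d) (t : ℝ) (ψ : Chain n d) : ‖evolve H t ψ‖ = ‖ψ‖ :=
  norm_exp_smul_apply H.isSelfAdjoint_ham t ψ

theorem evolve_sub (H : Interaction n d) (t : ℝ) (ψ φ : Chain n d) :
    evolve H t (ψ - φ) = evolve H t ψ - evolve H t φ := map_sub _ _ _

theorem evolve_zero (H : Interaction n d) (ψ : Chain n d) : evolve H 0 ψ = ψ :=
  exp_zero_smul_apply H.ham ψ

theorem evolve_add (H : Interaction n d) (s t : ℝ) (ψ : Chain n d) :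
    evolve H (s + t) ψ = evolve H s (evolve H t ψ) :=
  exp_add_smul_apply H.ham s t ψ

theorem hasDerivAt_evolve (H : Interaction n d) (ψ : Chain n d) (t : ℝ) :
    HasDerivAt (fun t => evolve H t ψ) (-(Complex.I • H.ham (evolve H t ψ))) t :=
  hasDerivAt_exp_smul_apply H.ham ψ t

theorem norm_evolve_sub_self_le (H : Interaction n d) {h : ℝ} (hH : ‖H.ham‖ ≤ h) {t : ℝ}
    (ht : 0 ≤ t) (ψ : Chain n d) : ‖evolve H t ψ - ψ‖ ≤ h * ‖ψ‖ * t := by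
  have := norm_image_sub_le_of_norm_deriv_le_segment' (f := fun t => evolve H t ψ)
    (fun x _ => (hasDerivAt_evolve H ψ x).hasDerivWithinAt) (C := h * ‖ψ‖) (fun x _ => ?_)
    t (Set.right_mem_Icc.2 ht)
  · simpa [evolve_zero] using this
  · rw [norm_neg, norm_smul, Complex.norm_I, one_mul, ← norm_evolve H x ψ]
    exact H.ham.le_of_opNorm_le hH _

/-- The difference has derivative `-iH (evolve H x ψ - ψ)`, of norm at most `h * (h * ‖ψ‖ * x)`, and
vanishes at `0`; integration yields the quadratic bound. -/
theorem norm_evolve_sub_eulerStep_le (H : Interaction n d) {h : ℝ} (hH : ‖H.ham‖ ≤ h) {t : ℝ}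
    (ht : 0 ≤ t) (ψ : Chain n d) :
    ‖evolve H t ψ - eulerStep H t ψ‖ ≤ (h * t) ^ 2 / 2 * ‖ψ‖ := by
  have hh : 0 ≤ h := (norm_nonneg _).trans hH
  have hd : ∀ x : ℝ, HasDerivAt (fun t : ℝ => evolve H t ψ - eulerStep H t ψ)
      (-(Complex.I • H.ham (evolve H x ψ - ψ))) x := by
    intro x
    have h1 : HasDerivAt (fun t : ℝ => eulerStep H t ψ) (-(Complex.I • H.ham ψ)) x := by
      have h2 : HasDerivAt (fun t : ℝ => t • (Complex.I • H.ham ψ)) ((1 : ℝ) • Complex.I • H.ham ψ)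
          x := (hasDerivAt_id x).smul_const _
      rw [one_smul] at h2
      convert! h2.const_sub ψ using 1
      funext t
      rw [eulerStep, ← Complex.coe_smul, smul_smul, mul_comm]
    convert! (hasDerivAt_evolve H ψ x).sub h1 using 1
    rw [map_sub, smul_sub]
    abel
  have := image_norm_le_of_norm_deriv_right_le_deriv_boundary
    (f := fun t : ℝ => evolve H t ψ - eulerStep H t ψ) (a := 0) (b := t)
    (f' := fun x => -(Complex.I • H.ham (evolve H x ψ - ψ)))
    (B := fun x => (h * x) ^ 2 / 2 * ‖ψ‖) (B' := fun x => h * (h * ‖ψ‖ * x))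
    (fun x _ => (hd x).continuousAt.continuousWithinAt)
    (fun x _ => (hd x).hasDerivWithinAt) (by simp [evolve_zero, eulerStep]) (fun x => ?_)
    (fun x hx => ?_) (Set.right_mem_Icc.2 ht)
  · exact this
  · have h1 := (((hasDerivAt_id x).const_mul h).pow 2).div_const 2 |>.mul_const ‖ψ‖
    convert! h1 using 1
    simp
    ring
  · rw [norm_neg, norm_smul, Complex.norm_I, one_mul]
    exact (H.ham.le_of_opNorm_le hH _).trans
      (mul_le_mul_of_nonneg_left (norm_evolve_sub_self_le H hH hx.1 ψ) hh)

/-! ### Runs of the algorithm -/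

theorem nonempty_run (H : Interaction n d) (t : ℝ) (N D : ℕ) (rescale : Bool) (ψ₀ : Chain n d) :
    Nonempty (Run H t N D rescale ψ₀) := by
  let form : ∀ ψ : Chain n d, CanonicalForm (eulerStep H (t / N) ψ) := fun ψ c =>
    (SchmidtDecomposition.exists_schmidtDecomposition _).some
  exact ⟨⟨fun m => Nat.rec ψ₀ (fun _ ψ => if rescale then clip (truncate D (form ψ))
    else truncate D (form ψ)) m, fun m => form _, rfl, fun m => rfl⟩⟩

namespace Run

variable {H : Interaction n d} {t : ℝ} {N D : ℕ} {rescale : Bool} {ψ₀ : Chain n d}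

theorem isMPS_state (R : Run H t N D rescale ψ₀) (hD : 1 ≤ D) (hn : 1 ≤ n)
    (hψ₀ : IsProductState ψ₀) (m : ℕ) : IsMPS D (R.state m) := by
  cases m with
  | zero => rw [R.state_zero]; exact hψ₀.isMPS hD hn
  | succ m =>
    rw [R.state_succ]
    have h := isMPS_truncate hD hn (R.form m)
    split_ifs
    · rw [clip_eq]; exact h.smul hn _
    · exact h

theorem cutNorm_state_succ_le (R : Run H t N D rescale ψ₀) (m : ℕ) (c : Fin (n - 1)) :
    cutNorm (c.val + 1) (R.state (m + 1)) ≤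
      cutNorm (c.val + 1) (eulerStep H (t / N) (R.state m)) := by
  rw [R.state_succ]
  have h := cutNorm_truncate_le D (R.form m) c
  split_ifs
  · exact (cutNorm_clip_le _ _).trans h
  · exact h

theorem sum_form_eq (R : Run H t N D rescale ψ₀) (m : ℕ) (c : Fin (n - 1)) :
    (R.form m c).sum = cutNorm (c.val + 1) (eulerStep H (t / N) (R.state m)) :=
  (R.form m c).sum_eq_nuclearNorm

theorem sum_le_sum_form (R : Run H t N D rescale ψ₀) (m : ℕ) (c : Fin (n - 1))
    (S : SchmidtDecomposition (cutAmp (c.val + 1) (R.state (m + 1)))) :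
    S.sum ≤ (R.form m c).sum := by
  rw [R.sum_form_eq, S.sum_eq_nuclearNorm]
  exact R.cutNorm_state_succ_le m c

/-- A step multiplies the sum by at most `1 + K ≤ exp K`; truncation and rescaling do not increase
it, and it starts at no more than `1`. -/
theorem cutNorm_eulerStep_state_le (R : Run H t N D rescale ψ₀) {g : ℝ}
    (hg : H.OneSiteEnergyLE g) (ht : 0 ≤ t) (hψ₀ : IsProductState ψ₀) {J : ℝ≥0}
    (hJ : ∀ c : Fin (n - 1), seStrength (c.val + 1) (H.boundary (c.val + 1)) ≤ (J : ℝ≥0∞))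
    (c : Fin (n - 1)) (m : ℕ) :
    cutNorm (c.val + 1) (eulerStep H (t / N) (R.state m)) ≤
      Real.exp ((m + 1 : ℕ) * (J * (t / N) + (g * n * (t / N)) ^ 2 / 2)) := by
  have hτ : 0 ≤ t / N := by positivity
  set K : ℝ := J * (t / N) + (g * n * (t / N)) ^ 2 / 2 with hK
  have step : ∀ (ψ : Chain n d) (k : ℕ), cutNorm (c.val + 1) ψ ≤ Real.exp (k * K) →
      cutNorm (c.val + 1) (eulerStep H (t / N) ψ) ≤ Real.exp ((k + 1 : ℕ) * K) := by
    intro ψ k hψ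
    refine (cutNorm_eulerStep_le hg hτ (hJ c) ψ).trans ?_
    have h1 : 1 + K ≤ Real.exp K := by linarith [Real.add_one_le_exp K]
    have : ((k + 1 : ℕ) : ℝ) * K = K + k * K := by push_cast; ring
    rw [this, Real.exp_add]
    exact mul_le_mul h1 hψ (cutNorm_nonneg _ _) (Real.exp_pos _).le
  induction m with
  | zero =>
    refine step _ 0 ?_
    rw [R.state_zero]
    simpa using hψ₀.cutNorm_le_one (c.val + 1)
  | succ m ih => exact step _ (m + 1) ((R.cutNorm_state_succ_le m c).trans ih)

/-- The sums of the Schmidt coefficients during the first `N` steps. -/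
theorem sum_form_le (R : Run H t N D rescale ψ₀) {g : ℝ}
    (hg : H.OneSiteEnergyLE g) (ht : 0 ≤ t) (hψ₀ : IsProductState ψ₀) {J : ℝ≥0}
    (hJ : ∀ c : Fin (n - 1), seStrength (c.val + 1) (H.boundary (c.val + 1)) ≤ (J : ℝ≥0∞))
    {m : ℕ} (hm : m < N) (c : Fin (n - 1)) :
    (R.form m c).sum ≤ Real.exp (J * t + (g * n * t) ^ 2 / N / 2) := by
  rw [R.sum_form_eq]
  refine (R.cutNorm_eulerStep_state_le hg ht hψ₀ hJ c m).trans (Real.exp_le_exp.2 ?_)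
  have hN : (0 : ℝ) < N := by exact_mod_cast (Nat.zero_le m).trans_lt hm
  have h1 : ((m + 1 : ℕ) : ℝ) ≤ N := by exact_mod_cast hm
  calc ((m + 1 : ℕ) : ℝ) * (J * (t / N) + (g * n * (t / N)) ^ 2 / 2)
      ≤ N * (J * (t / N) + (g * n * (t / N)) ^ 2 / 2) := by
        refine mul_le_mul_of_nonneg_right h1 ?_
        have := J.2
        positivity
    _ = J * t + (g * n * t) ^ 2 / N / 2 := by field_simp

theorem tail_form_le (R : Run H t N D rescale ψ₀) {g : ℝ}
    (hg : H.OneSiteEnergyLE g) (ht : 0 ≤ t) (hψ₀ : IsProductState ψ₀) {J : ℝ≥0}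
    (hJ : ∀ c : Fin (n - 1), seStrength (c.val + 1) (H.boundary (c.val + 1)) ≤ (J : ℝ≥0∞))
    (hD : 1 ≤ D) {m : ℕ} (hm : m < N) (c : Fin (n - 1)) :
    (R.form m c).tail D ≤ Real.exp (J * t + (g * n * t) ^ 2 / N / 2) / Real.sqrt D :=
  ((R.form m c).tail_le hD).trans
    (div_le_div_of_nonneg_right (R.sum_form_le hg ht hψ₀ hJ hm c) (Real.sqrt_nonneg _))

theorem norm_state_le_one (R : Run H t N D true ψ₀) (hψ₀ : IsProductState ψ₀) (m : ℕ) :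
    ‖R.state m‖ ≤ 1 := by
  cases m with
  | zero => rw [R.state_zero, hψ₀.norm_eq_one]
  | succ m =>
    rw [R.state_succ, if_pos rfl]
    exact norm_clip_le _

theorem norm_eulerStep_le {g : ℝ} (hg : H.OneSiteEnergyLE g) (τ : ℝ) (ψ : Chain n d) :
    ‖eulerStep H τ ψ‖ ≤ (1 + (g * n * τ) ^ 2 / 2) * ‖ψ‖ := by
  have h := norm_one_sub_smul_sq_le H.isSelfAdjoint_ham τ (Interaction.norm_ham_le hg)
  have h1 : ‖1 - (Complex.I * (τ : ℂ)) • H.ham‖ ≤ 1 + (g * n * τ) ^ 2 / 2 := by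
    refine le_of_sq_le_sq (h.trans ?_) (by positivity)
    nlinarith [sq_nonneg ((g * n * τ) ^ 2)]
  exact ContinuousLinearMap.le_of_opNorm_le _ h1 ψ

theorem norm_state_le (R : Run H t N D rescale ψ₀) {g : ℝ} (hg : H.OneSiteEnergyLE g)
    (hψ₀ : IsProductState ψ₀) (hr : rescale = false) (m : ℕ) :
    ‖R.state m‖ ≤ (1 + (g * n * (t / N)) ^ 2 / 2) ^ m := by
  induction m with
  | zero => rw [R.state_zero, hψ₀.norm_eq_one, pow_zero]
  | succ m ih =>
    rw [R.state_succ, if_neg (by simp [hr]), pow_succ']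
    exact ((norm_truncate_le D (R.form m)).trans (norm_eulerStep_le hg _ _)).trans
      (mul_le_mul_of_nonneg_left ih (by positivity))

/-- The error grows in one step by the error of the first-order step and the truncation error. -/
theorem norm_evolve_sub_state_succ_le (R : Run H t N D rescale ψ₀) {g : ℝ}
    (hg : H.OneSiteEnergyLE g) (ht : 0 ≤ t) (hψ₀ : IsProductState ψ₀) {δ : ℝ} (hδ : 0 ≤ δ) (m : ℕ)
    (h : ∀ c, (R.form m c).tail D ≤ δ) :
    ‖evolve H ((m + 1 : ℕ) * (t / N)) ψ₀ - R.state (m + 1)‖ ≤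
      ‖evolve H (m * (t / N)) ψ₀ - R.state m‖ +
        (g * n * (t / N)) ^ 2 / 2 * ‖R.state m‖ + Real.sqrt n * δ := by
  have hτ : 0 ≤ t / N := by positivity
  set τ := t / N with hτdef
  set T := truncate D (R.form m) with hT
  -- The exact state has norm one, so rescaling can only reduce the distance to it.
  have h1 : ‖evolve H ((m + 1 : ℕ) * τ) ψ₀ - R.state (m + 1)‖ ≤
      ‖evolve H ((m + 1 : ℕ) * τ) ψ₀ - T‖ := by
    rw [R.state_succ]
    split_ifs
    · exact norm_sub_clip_le (by rw [norm_evolve, hψ₀.norm_eq_one]) _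
    · exact le_rfl
  refine h1.trans ?_
  have e1 : ((m + 1 : ℕ) : ℝ) * τ = τ + m * τ := by push_cast; ring
  -- The propagated old error, the error of the first-order step, and the truncation error.
  have e2 : evolve H ((m + 1 : ℕ) * τ) ψ₀ - T =
      evolve H τ (evolve H (m * τ) ψ₀ - R.state m) +
        (evolve H τ (R.state m) - eulerStep H τ (R.state m)) +
        (eulerStep H τ (R.state m) - T) := by
    rw [e1, evolve_add, evolve_sub]
    abel
  rw [e2]
  refine (norm_add₃_le).trans ?_
  rw [norm_evolve]
  have h2 := norm_evolve_sub_eulerStep_le H (Interaction.norm_ham_le hg) hτ (R.state m)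
  have h3 := norm_sub_truncate_le D (R.form m) hδ h
  linarith

theorem norm_evolve_sub_state_le_of_rescale (R : Run H t N D rescale ψ₀) {g : ℝ}
    (hg : H.OneSiteEnergyLE g) (ht : 0 ≤ t) (hψ₀ : IsProductState ψ₀) {δ : ℝ} (hδ : 0 ≤ δ)
    (h : ∀ m < N, ∀ c, (R.form m c).tail D ≤ δ) (hr : rescale = true) {m : ℕ} (hm : m ≤ N) :
    ‖evolve H (m * (t / N)) ψ₀ - R.state m‖ ≤
      m * ((g * n * (t / N)) ^ 2 / 2) + m * (Real.sqrt n * δ) := by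
  subst hr
  induction m with
  | zero => simp [evolve_zero, R.state_zero]
  | succ m ih =>
    refine (R.norm_evolve_sub_state_succ_le hg ht hψ₀ hδ m (h m hm)).trans ?_
    have h1 := mul_le_mul_of_nonneg_left (R.norm_state_le_one hψ₀ m)
      (show 0 ≤ (g * n * (t / N)) ^ 2 / 2 by positivity)
    have h2 := ih (by omega)
    push_cast
    linarith

/-- Without rescaling, `‖M_m‖ ≤ (1 + a)^m` with `a = (gnτ)²/2`, and the Euler errors `a (1 + a)^m`
telescope to a difference of powers. -/
theorem norm_evolve_sub_state_le_of_plain (R : Run H t N D rescale ψ₀) {g : ℝ}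
    (hg : H.OneSiteEnergyLE g) (ht : 0 ≤ t) (hψ₀ : IsProductState ψ₀) {δ : ℝ} (hδ : 0 ≤ δ)
    (h : ∀ m < N, ∀ c, (R.form m c).tail D ≤ δ) (hr : rescale = false) {m : ℕ} (hm : m ≤ N) :
    ‖evolve H (m * (t / N)) ψ₀ - R.state m‖ ≤
      ((1 + (g * n * (t / N)) ^ 2 / 2) ^ m - 1) + m * (Real.sqrt n * δ) := by
  induction m with
  | zero => simp [evolve_zero, R.state_zero]
  | succ m ih =>
    refine (R.norm_evolve_sub_state_succ_le hg ht hψ₀ hδ m (h m hm)).trans ?_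
    have h1 := mul_le_mul_of_nonneg_left (R.norm_state_le hg hψ₀ hr m)
      (show 0 ≤ (g * n * (t / N)) ^ 2 / 2 by positivity)
    have h2 := ih (by omega)
    push_cast
    rw [pow_succ (1 + _)]
    linarith

/-- The total error. -/
theorem norm_evolve_sub_state_le (R : Run H t N D rescale ψ₀) {g : ℝ}
    (hg : H.OneSiteEnergyLE g) (ht : 0 ≤ t) (hψ₀ : IsProductState ψ₀) {J : ℝ≥0}
    (hJ : ∀ c : Fin (n - 1), seStrength (c.val + 1) (H.boundary (c.val + 1)) ≤ (J : ℝ≥0∞))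
    (hN : 1 ≤ N) (hD : 1 ≤ D) (hr : rescale = true ∨ (g * n * t) ^ 2 / N ≤ 2) :
    ‖evolve H t ψ₀ - R.state N‖ ≤ (g * n * t) ^ 2 / N +
      N * Real.sqrt (2 * n / D) * Real.exp (J * t + (g * n * t) ^ 2 / N) := by
  have hN0 : (0 : ℝ) < N := by exact_mod_cast hN
  have hD0 : (0 : ℝ) < D := by exact_mod_cast hD
  set y : ℝ := (g * n * t) ^ 2 / N with hy
  have hy0 : 0 ≤ y := by positivity
  set δ : ℝ := Real.exp (J * t + y / 2) / Real.sqrt D with hδdef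
  have hδ : 0 ≤ δ := by positivity
  have htail : ∀ m < N, ∀ c, (R.form m c).tail D ≤ δ := fun m hm c =>
    R.tail_form_le hg ht hψ₀ hJ hD hm c
  have hNt : (N : ℝ) * (t / N) = t := by field_simp
  have ha : (N : ℝ) * ((g * n * (t / N)) ^ 2 / 2) = y / 2 := by
    rw [hy]; field_simp
  have htrunc : N * (Real.sqrt n * δ) ≤ N * Real.sqrt (2 * n / D) * Real.exp (J * t + y) := by
    rw [mul_assoc]
    refine mul_le_mul_of_nonneg_left ?_ hN0.le
    have h1 : Real.sqrt n * δ = Real.sqrt (n / D) * Real.exp (J * t + y / 2) := by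
      rw [hδdef, Real.sqrt_div (Nat.cast_nonneg n)]
      ring
    rw [h1]
    refine mul_le_mul (Real.sqrt_le_sqrt ?_) (Real.exp_le_exp.2 (by linarith))
      (Real.exp_pos _).le (Real.sqrt_nonneg _)
    have : (0 : ℝ) ≤ n := Nat.cast_nonneg n
    gcongr
    linarith
  have hmain : ‖evolve H t ψ₀ - R.state N‖ ≤ y + N * (Real.sqrt n * δ) := by
    rcases Bool.eq_false_or_eq_true rescale with hrb | hrb
    · have := R.norm_evolve_sub_state_le_of_rescale hg ht hψ₀ hδ htail hrb le_rfl
      rw [hNt, ha] at this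
      linarith
    · have := R.norm_evolve_sub_state_le_of_plain hg ht hψ₀ hδ htail hrb le_rfl
      rw [hNt] at this
      have hy2 : y ≤ 2 := hr.resolve_left (by simp [hrb])
      have h1 : (1 + (g * n * (t / N)) ^ 2 / 2) ^ N ≤ Real.exp (y / 2) := by
        rw [← ha, Real.exp_nat_mul]
        refine pow_le_pow_left₀ (by positivity) ?_ N
        linarith [Real.add_one_le_exp ((g * n * (t / N)) ^ 2 / 2)]
      -- The condition `y ≤ 2` enters here: `exp (y/2) - 1 ≤ y/2 + (y/2)² ≤ y`.
      have h2 := (abs_le.1 (Real.abs_exp_sub_one_sub_id_le (x := y / 2)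
        (by rw [abs_of_nonneg (by linarith)]; linarith))).2
      have h3 : (y / 2) ^ 2 ≤ y / 2 := by nlinarith
      linarith
  linarith

theorem truncError_le (R : Run H t N D rescale ψ₀) {g : ℝ}
    (hg : H.OneSiteEnergyLE g) (ht : 0 ≤ t) (hψ₀ : IsProductState ψ₀) {J : ℝ≥0}
    (hJ : ∀ c : Fin (n - 1), seStrength (c.val + 1) (H.boundary (c.val + 1)) ≤ (J : ℝ≥0∞))
    (hD : 1 ≤ D) {m : ℕ} (hm : m < N) :
    R.truncError m ≤ Real.exp (J * t + (g * n * t) ^ 2 / N) / Real.sqrt D := by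
  refine Real.iSup_le (fun c => (R.tail_form_le hg ht hψ₀ hJ hD hm c).trans ?_) (by positivity)
  refine div_le_div_of_nonneg_right (Real.exp_le_exp.2 ?_) (Real.sqrt_nonneg _)
  have : 0 ≤ (g * n * t) ^ 2 / (N : ℝ) := by positivity
  linarith

end Run

/-- Polynomial time steps and bond dimensions that suffice for a total error `ε`. -/
theorem exists_steps_bondDim (hn : 1 ≤ n) {x κ ε : ℝ} (hκ : 0 ≤ κ) (hε : 0 < ε)
    (hε1 : ε ≤ 1) : ∃ N D : ℕ, 1 ≤ N ∧ 1 ≤ D ∧ x ≤ N ∧ (N : ℝ) ≤ 2 * x ^ 2 / ε + 1 ∧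
      (D : ℝ) ≤ 100 * Real.exp (2 * κ) * n * (1 + x ^ 2) ^ 2 / ε ^ 4 ∧ x ^ 2 / N ≤ 2 ∧
      x ^ 2 / N + N * Real.sqrt (2 * n / D) * Real.exp (κ + x ^ 2 / N) ≤ ε := by
  have hn1 : (1 : ℝ) ≤ n := by exact_mod_cast hn
  set A : ℝ := Real.exp (2 * κ) * n * (1 + x ^ 2) ^ 2 / ε ^ 4 with hA
  have hA1 : 1 ≤ A := by
    rw [hA, le_div_iff₀ (by positivity), one_mul]
    have h1 : ε ^ 4 ≤ 1 := pow_le_one₀ hε.le hε1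
    have h2 : 1 ≤ Real.exp (2 * κ) := Real.one_le_exp (by linarith)
    have h3 : 1 ≤ (1 + x ^ 2) ^ 2 := one_le_pow₀ (by nlinarith [sq_nonneg x])
    exact h1.trans (one_le_mul_of_one_le_of_one_le (one_le_mul_of_one_le_of_one_le h2 hn1) h3)
  have hx2 : 0 ≤ 2 * x ^ 2 / ε := by positivity
  -- `N` gives half of `ε` to the time-step error. `D` makes the truncation part at most `ε / 2`;
  -- rounding costs at most one unit, so `D ≥ 99 A` because `A ≥ 1`.
  set N : ℕ := ⌊2 * x ^ 2 / ε⌋₊ + 1 with hN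
  set D : ℕ := ⌊100 * A⌋₊ with hD
  have hN1 : (1 : ℝ) ≤ N := by rw [hN]; push_cast; linarith [Nat.cast_nonneg (α := ℝ) ⌊2 * x ^ 2 / ε⌋₊]
  have hN0 : (0 : ℝ) < N := by linarith
  have hNlt : 2 * x ^ 2 / ε < N := by rw [hN]; push_cast; exact Nat.lt_floor_add_one _
  have hNle : (N : ℝ) ≤ 2 * x ^ 2 / ε + 1 := by
    rw [hN]; push_cast; linarith [Nat.floor_le hx2]
  have hDle : (D : ℝ) ≤ 100 * A := Nat.floor_le (by linarith)
  have hDge : 99 * A ≤ D := by linarith [Nat.lt_floor_add_one (100 * A)]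
  have hD0 : (0 : ℝ) < D := by linarith
  have hy : x ^ 2 / N ≤ ε / 2 := by
    rw [div_lt_iff₀ hε] at hNlt
    rw [div_le_iff₀ hN0]
    linarith
  refine ⟨N, D, by omega, by exact_mod_cast hD0, ?_, hNle, ?_, by linarith, ?_⟩
  -- If `N < x`, then `2x² ≤ 2x²/ε < N < x`, impossible as `x > N ≥ 1`.
  · by_contra! h
    have h1 : 2 * x ^ 2 ≤ 2 * x ^ 2 / ε := by
      rw [le_div_iff₀ hε]
      nlinarith [sq_nonneg x]
    nlinarith
  · refine hDle.trans (le_of_eq ?_)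
    rw [hA]
    ring
  · have hB : N * Real.sqrt (2 * n / D) * Real.exp (κ + x ^ 2 / N) ≤ ε / 2 := by
      refine le_of_sq_le_sq ?_ (by positivity)
      have hexp : Real.exp (κ + x ^ 2 / N) ^ 2 ≤ Real.exp (2 * κ) * 2.7182818286 := by
        rw [← Real.exp_nat_mul]
        refine le_trans (Real.exp_le_exp.2 (show _ ≤ 2 * κ + 1 by push_cast; linarith)) ?_
        rw [Real.exp_add]
        exact mul_le_mul_of_nonneg_left Real.exp_one_lt_d9.le (Real.exp_pos _).le
      have hN2 : (N : ℝ) ≤ 2 * (1 + x ^ 2) / ε := by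
        refine hNle.trans ?_
        rw [le_div_iff₀ hε, add_mul, div_mul_cancel₀ _ hε.ne']
        linarith
      have hNsq : (N : ℝ) ^ 2 ≤ 4 * (1 + x ^ 2) ^ 2 / ε ^ 2 := by
        refine (pow_le_pow_left₀ hN0.le hN2 2).trans (le_of_eq ?_)
        ring
      rw [mul_pow, mul_pow, Real.sq_sqrt (by positivity)]
      -- All factors cancel against `A` except `8e/99 < 1/4`.
      calc (N : ℝ) ^ 2 * (2 * n / D) * Real.exp (κ + x ^ 2 / N) ^ 2
          ≤ (4 * (1 + x ^ 2) ^ 2 / ε ^ 2) * (2 * n / (99 * A)) *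
              (Real.exp (2 * κ) * 2.7182818286) := by gcongr
        _ = (8 * 2.7182818286 / 99) * ε ^ 2 := by
            rw [hA]
            field_simp
            ring
        _ ≤ (ε / 2) ^ 2 := by nlinarith [sq_nonneg ε]
    linarith

/-! ### Bounds on the spectral entangling strength -/

theorem seStrength_le_of_forall {s : ℕ} {O : Op n d} {c : ℝ}
    (h : ∀ (p q : ℕ) (φ : EuclideanSpace ℂ (LCfg n d s × Fin p))
      (χ : EuclideanSpace ℂ (RCfg n d s × Fin q)), ‖φ‖ = 1 → ‖χ‖ = 1 →
        nuclearNorm (ancillaAmp s O φ χ) ≤ c) : seStrength s O ≤ ENNReal.ofReal c := by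
  refine iSup_le fun p => iSup_le fun q => iSup_le fun φ => iSup_le fun χ => iSup_le fun hφ =>
    iSup_le fun hχ => iSup_le fun S => ENNReal.ofReal_le_ofReal ?_
  rw [S.sum_eq_nuclearNorm]
  exact h p q φ χ hφ hχ

theorem nuclearNorm_ancillaAmp_sum_le {ι : Type*} (F : Finset ι) (s : ℕ) (O : ι → Op n d)
    {p q : ℕ} (φ : EuclideanSpace ℂ (LCfg n d s × Fin p))
    (χ : EuclideanSpace ℂ (RCfg n d s × Fin q)) :
    nuclearNorm (ancillaAmp s (∑ i ∈ F, O i) φ χ) ≤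
      ∑ i ∈ F, nuclearNorm (ancillaAmp s (O i) φ χ) := by
  have : ancillaAmp s (∑ i ∈ F, O i) φ χ = fun a b => ∑ i ∈ F, ancillaAmp s (O i) φ χ a b := by
    funext a b
    simp [ancillaAmp, sum_apply]
  rw [this]
  exact nuclearNorm_sum_le F _

/-- `O ⊗ 1` is bounded by `‖O‖`: the vector is sliced along the ancilla bases, each slice is a
product vector on the chain, and the squared slice norms sum to one. -/
theorem sum_norm_sq_ancillaAmp_le (s : ℕ) (O : Op n d) {p q : ℕ}
    (φ : EuclideanSpace ℂ (LCfg n d s × Fin p)) (χ : EuclideanSpace ℂ (RCfg n d s × Fin q))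
    (hφ : ‖φ‖ = 1) (hχ : ‖χ‖ = 1) :
    ∑ a, ∑ b, ‖ancillaAmp s O φ χ a b‖ ^ 2 ≤ ‖O‖ ^ 2 := by
  let f : Fin p → EuclideanSpace ℂ (LCfg n d s) := fun i => WithLp.toLp 2 fun a => φ (a, i)
  let g : Fin q → EuclideanSpace ℂ (RCfg n d s) := fun j => WithLp.toLp 2 fun b => χ (b, j)
  have hf : ∑ i, ‖f i‖ ^ 2 = 1 := by
    rw [← one_pow 2, ← hφ, EuclideanSpace.norm_sq_eq φ, Fintype.sum_prod_type, Finset.sum_comm]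
    exact Finset.sum_congr rfl fun i _ => EuclideanSpace.norm_sq_eq _
  have hg : ∑ j, ‖g j‖ ^ 2 = 1 := by
    rw [← one_pow 2, ← hχ, EuclideanSpace.norm_sq_eq χ, Fintype.sum_prod_type, Finset.sum_comm]
    exact Finset.sum_congr rfl fun i _ => EuclideanSpace.norm_sq_eq _
  have h1 : ∑ a, ∑ b, ‖ancillaAmp s O φ χ a b‖ ^ 2 =
      ∑ i, ∑ j, ‖O (tens s (f i) (g j))‖ ^ 2 := by
    simp_rw [Fintype.sum_prod_type, norm_sq_chain s]
    rw [Finset.sum_comm]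
    refine Finset.sum_congr rfl fun i _ => ?_
    conv_rhs => rw [Finset.sum_comm]
    refine Finset.sum_congr rfl fun a _ => ?_
    rw [Finset.sum_comm]
    rfl
  rw [h1]
  calc ∑ i, ∑ j, ‖O (tens s (f i) (g j))‖ ^ 2
      ≤ ∑ i, ∑ j, ‖O‖ ^ 2 * (‖f i‖ ^ 2 * ‖g j‖ ^ 2) := by
        refine Finset.sum_le_sum fun i _ => Finset.sum_le_sum fun j _ => ?_
        rw [← mul_pow, ← norm_tens, ← mul_pow]
        exact pow_le_pow_left₀ (norm_nonneg _) (O.le_opNorm _) 2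
    _ = ‖O‖ ^ 2 := by
        simp_rw [← Finset.mul_sum]
        rw [hg]
        simp_rw [mul_one]
        rw [hf, mul_one]

/-- Only the number of terms matters, as a bound on the Schmidt rank; the `a k` and `b k` need no
norm control, because Cauchy–Schwarz uses the norm of the whole vector. -/
theorem nuclearNorm_ancillaAmp_le_of_expand {s : ℕ} {O : Op n d} {p q : ℕ}
    {φ : EuclideanSpace ℂ (LCfg n d s × Fin p)} {χ : EuclideanSpace ℂ (RCfg n d s × Fin q)}
    (hφ : ‖φ‖ = 1) (hχ : ‖χ‖ = 1) {ι : Type*} [Fintype ι] (a : ι → LCfg n d s × Fin p → ℂ)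
    (b : ι → RCfg n d s × Fin q → ℂ)
    (h : ∀ x y, ancillaAmp s O φ χ x y = ∑ k, a k x * b k y) :
    nuclearNorm (ancillaAmp s O φ χ) ≤ Real.sqrt (Fintype.card ι) * ‖O‖ := by
  obtain ⟨S⟩ := SchmidtDecomposition.exists_schmidtDecomposition (ancillaAmp s O φ χ)
  rw [← S.sum_eq_nuclearNorm]
  refine S.sum_le_sqrt_rank.trans (mul_le_mul (Real.sqrt_le_sqrt ?_) ?_ (Real.sqrt_nonneg _)
    (Real.sqrt_nonneg _))
  · exact_mod_cast S.rank_le a b h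
  · exact Real.sqrt_le_iff.2 ⟨norm_nonneg _, sum_norm_sq_ancillaAmp_le s O φ χ hφ hχ⟩

theorem IsProductOp.nuclearNorm_ancillaAmp_le {O : Op n d} (hO : IsProductOp O) {s p q : ℕ}
    {φ : EuclideanSpace ℂ (LCfg n d s × Fin p)} {χ : EuclideanSpace ℂ (RCfg n d s × Fin q)}
    (hφ : ‖φ‖ = 1) (hχ : ‖χ‖ = 1) : nuclearNorm (ancillaAmp s O φ χ) ≤ ‖O‖ := by
  obtain ⟨u, hu⟩ := hO
  have := nuclearNorm_ancillaAmp_le_of_expand hφ hχ (ι := Unit) (O := O)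
    (fun _ x => ∑ y : LCfg n d s, (∏ i, u i.1 (x.1 i) (y i)) * φ (y, x.2))
    (fun _ x => ∑ y : RCfg n d s, (∏ i, u i.1 (x.1 i) (y i)) * χ (y, x.2)) (fun x y => by
      rw [ancillaAmp, hu, sum_cfg_eq s]
      simp only [Finset.univ_unique, Finset.sum_const, Finset.card_singleton, one_smul,
        Finset.sum_mul_sum]
      refine Finset.sum_congr rfl fun a _ => Finset.sum_congr rfl fun b _ => ?_
      rw [← Fintype.prod_subtype_mul_prod_subtype (fun i : Fin n => i.val < s)]
      have e1 : ∀ i : {i : Fin n // i.val < s}, u i.1 (glue s x.1 y.1 i.1) (glue s a b i.1) =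
          u i.1 (x.1 i) (a i) := fun i => by simp [glue, i.2]
      have e2 : ∀ i : {i : Fin n // ¬ i.val < s}, u i.1 (glue s x.1 y.1 i.1) (glue s a b i.1) =
          u i.1 (y.1 i) (b i) := fun i => by simp only [glue]; rw [dif_neg i.2, dif_neg i.2]
      simp_rw [e1, e2, lpart_glue, rpart_glue]
      ring)
  simpa using this

/-- Fixing the output and the input configuration on the sites of `Z` left of the cut makes the two
sides factorize. With `m` such sites there are `d^(2m)` terms, and the square root gives `d^m`. -/
theorem SupportedOn.nuclearNorm_ancillaAmp_le_left {Z : Finset (Fin n)} {O : Op n d}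
    (hO : SupportedOn Z O) {s p q : ℕ}
    {φ : EuclideanSpace ℂ (LCfg n d s × Fin p)} {χ : EuclideanSpace ℂ (RCfg n d s × Fin q)}
    (hφ : ‖φ‖ = 1) (hχ : ‖χ‖ = 1) :
    nuclearNorm (ancillaAmp s O φ χ) ≤
      (d : ℝ) ^ Fintype.card {i : Fin n // i ∈ Z ∧ i.val < s} * ‖O‖ := by
  obtain ⟨K, hK⟩ := hO
  let W : Type := {i : Fin n // i ∈ Z ∧ i.val < s} → Fin d
  -- `k.1` is the output configuration, matched with `x`; `k.2` is the input one, to which the sum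
  -- over `z` on the right is restricted.
  have := nuclearNorm_ancillaAmp_le_of_expand hφ hχ (ι := W × W) (O := O)
    (fun k x => if k.1 = (fun w => x.1 ⟨w.1, w.2.2⟩) then
      φ (fun l => if h : l.1 ∈ Z then k.2 ⟨l.1, h, l.2⟩ else x.1 l, x.2) else 0)
    (fun k y => ∑ z ∈ Finset.univ.filter (fun z : {i // i ∈ Z} → Fin d =>
        (fun w : {i : Fin n // i ∈ Z ∧ i.val < s} => z ⟨w.1, w.2.1⟩) = k.2),
      K (fun i => if h : i.1.val < s then k.1 ⟨i.1, i.2, h⟩ else y.1 ⟨i.1, h⟩) z *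
        χ (fun r => if h : r.1 ∈ Z then z ⟨r.1, h⟩ else y.1 r, y.2)) (fun x y => by
      rw [ancillaAmp, hK, Fintype.sum_prod_type]
      simp only [ite_mul, zero_mul]
      rw [Finset.sum_comm]
      simp only [Finset.sum_ite_eq', Finset.mem_univ, if_true, Finset.mul_sum]
      rw [← Finset.sum_fiberwise Finset.univ (fun z : {i // i ∈ Z} → Fin d =>
        (fun w : {i : Fin n // i ∈ Z ∧ i.val < s} => z ⟨w.1, w.2.1⟩))]
      refine Finset.sum_congr rfl fun β _ => Finset.sum_congr rfl fun z hz => ?_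
      obtain rfl := (Finset.mem_filter.1 hz).2
      have e1 : (fun i : {i // i ∈ Z} => glue s x.1 y.1 i.1) = fun i : {i // i ∈ Z} =>
          if h : i.1.val < s then x.1 ⟨i.1, h⟩ else y.1 ⟨i.1, h⟩ := rfl
      have e2 : lpart s (fun i => if h : i ∈ Z then z ⟨i, h⟩ else glue s x.1 y.1 i) =
          fun l => if h : l.1 ∈ Z then z ⟨l.1, h⟩ else x.1 l := by
        funext l
        simp [lpart, glue, l.2]
      have e3 : rpart s (fun i => if h : i ∈ Z then z ⟨i, h⟩ else glue s x.1 y.1 i) =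
          fun r => if h : r.1 ∈ Z then z ⟨r.1, h⟩ else y.1 r := by
        funext r
        simp only [rpart, glue]
        rw [dif_neg r.2]
      rw [e1, e2, e3]
      ring)
  refine this.trans (mul_le_mul_of_nonneg_right ?_ (norm_nonneg _))
  rw [Fintype.card_prod, Fintype.card_fun, Fintype.card_fin, Nat.cast_mul,
    Real.sqrt_mul_self (Nat.cast_nonneg _)]
  push_cast
  exact le_rfl

theorem SupportedOn.nuclearNorm_ancillaAmp_le_right {Z : Finset (Fin n)} {O : Op n d}
    (hO : SupportedOn Z O) {s p q : ℕ}
    {φ : EuclideanSpace ℂ (LCfg n d s × Fin p)} {χ : EuclideanSpace ℂ (RCfg n d s × Fin q)}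
    (hφ : ‖φ‖ = 1) (hχ : ‖χ‖ = 1) :
    nuclearNorm (ancillaAmp s O φ χ) ≤
      (d : ℝ) ^ Fintype.card {i : Fin n // i ∈ Z ∧ ¬ i.val < s} * ‖O‖ := by
  obtain ⟨K, hK⟩ := hO
  let W : Type := {i : Fin n // i ∈ Z ∧ ¬ i.val < s} → Fin d
  have := nuclearNorm_ancillaAmp_le_of_expand hφ hχ (ι := W × W) (O := O)
    (fun k x => ∑ z ∈ Finset.univ.filter (fun z : {i // i ∈ Z} → Fin d =>
        (fun w : {i : Fin n // i ∈ Z ∧ ¬ i.val < s} => z ⟨w.1, w.2.1⟩) = k.2),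
      K (fun i => if h : i.1.val < s then x.1 ⟨i.1, h⟩ else k.1 ⟨i.1, i.2, h⟩) z *
        φ (fun l => if h : l.1 ∈ Z then z ⟨l.1, h⟩ else x.1 l, x.2))
    (fun k y => if k.1 = (fun w => y.1 ⟨w.1, w.2.2⟩) then
      χ (fun r => if h : r.1 ∈ Z then k.2 ⟨r.1, h, r.2⟩ else y.1 r, y.2) else 0) (fun x y => by
      rw [ancillaAmp, hK, Fintype.sum_prod_type]
      simp only [mul_ite, mul_zero]
      rw [Finset.sum_comm]
      simp only [Finset.sum_ite_eq', Finset.mem_univ, if_true, Finset.sum_mul]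
      rw [← Finset.sum_fiberwise Finset.univ (fun z : {i // i ∈ Z} → Fin d =>
        (fun w : {i : Fin n // i ∈ Z ∧ ¬ i.val < s} => z ⟨w.1, w.2.1⟩))]
      refine Finset.sum_congr rfl fun β _ => Finset.sum_congr rfl fun z hz => ?_
      obtain rfl := (Finset.mem_filter.1 hz).2
      have e1 : (fun i : {i // i ∈ Z} => glue s x.1 y.1 i.1) = fun i : {i // i ∈ Z} =>
          if h : i.1.val < s then x.1 ⟨i.1, h⟩ else y.1 ⟨i.1, h⟩ := rfl
      have e2 : lpart s (fun i => if h : i ∈ Z then z ⟨i, h⟩ else glue s x.1 y.1 i) =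
          fun l => if h : l.1 ∈ Z then z ⟨l.1, h⟩ else x.1 l := by
        funext l
        simp [lpart, glue, l.2]
      have e3 : rpart s (fun i => if h : i ∈ Z then z ⟨i, h⟩ else glue s x.1 y.1 i) =
          fun r => if h : r.1 ∈ Z then z ⟨r.1, h⟩ else y.1 r := by
        funext r
        simp only [rpart, glue]
        rw [dif_neg r.2]
      rw [e1, e2, e3]
      ring)
  refine this.trans (mul_le_mul_of_nonneg_right ?_ (norm_nonneg _))
  rw [Fintype.card_prod, Fintype.card_fun, Fintype.card_fin, Nat.cast_mul,
    Real.sqrt_mul_self (Nat.cast_nonneg _)]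
  push_cast
  exact le_rfl

/-- The side of the cut with fewer sites of `Z` has at most `k / 2` of them. -/
theorem SupportedOn.nuclearNorm_ancillaAmp_le {Z : Finset (Fin n)} {O : Op n d}
    (hO : SupportedOn Z O) {k : ℕ} (hZ : Z.card ≤ k) (hd : 1 ≤ d) {s p q : ℕ}
    {φ : EuclideanSpace ℂ (LCfg n d s × Fin p)} {χ : EuclideanSpace ℂ (RCfg n d s × Fin q)}
    (hφ : ‖φ‖ = 1) (hχ : ‖χ‖ = 1) :
    nuclearNorm (ancillaAmp s O φ χ) ≤ (d : ℝ) ^ (k / 2) * ‖O‖ := by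
  have hd' : (1 : ℝ) ≤ d := by exact_mod_cast hd
  have hcard : Fintype.card {i : Fin n // i ∈ Z ∧ i.val < s} +
      Fintype.card {i : Fin n // i ∈ Z ∧ ¬ i.val < s} = Z.card := by
    rw [Fintype.card_subtype, Fintype.card_subtype,
      ← Finset.card_filter_add_card_filter_not (s := Z) (fun i : Fin n => i.val < s)]
    congr 2 <;> (ext i; simp)
  rcases le_total (Fintype.card {i : Fin n // i ∈ Z ∧ i.val < s})
    (Fintype.card {i : Fin n // i ∈ Z ∧ ¬ i.val < s}) with h | h
  · exact (hO.nuclearNorm_ancillaAmp_le_left hφ hχ).trans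
      (mul_le_mul_of_nonneg_right (pow_le_pow_right₀ hd' (by omega)) (norm_nonneg _))
  · exact (hO.nuclearNorm_ancillaAmp_le_right hφ hχ).trans
      (mul_le_mul_of_nonneg_right (pow_le_pow_right₀ hd' (by omega)) (norm_nonneg _))

/-! ### Power-law interactions -/

/-- A discrete integral comparison for `r ^ (-(q + 1))`, from `log u ≤ u - 1` at `u = m / (m + 1)`
and `1 + w ≤ exp w`. -/
theorem rpow_succ_le_telescope {q : ℝ} (hq : 0 < q) {m : ℕ} (hm : 1 ≤ m) :
    ((m + 1 : ℕ) : ℝ) * ((m + 1 : ℕ) : ℝ) ^ (-(q + 2)) ≤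
      (m : ℝ) ^ (-q) / q - ((m + 1 : ℕ) : ℝ) ^ (-q) / q := by
  have hm0 : (0 : ℝ) < m := by exact_mod_cast hm
  set M : ℝ := ((m + 1 : ℕ) : ℝ) with hM
  have hMm : M = m + 1 := by rw [hM]; push_cast; rfl
  have hM0 : 0 < M := by linarith
  have h1 : M * M ^ (-(q + 2)) = M ^ (-q) * M⁻¹ := by
    rw [← Real.rpow_one_add' hM0.le (by linarith), ← Real.rpow_neg_one M, ← Real.rpow_add hM0]
    congr 1
    ring
  have h2 : (m : ℝ) ^ (-q) = M ^ (-q) * (m / M) ^ (-q) := by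
    rw [← Real.mul_rpow hM0.le (by positivity), mul_div_cancel₀ _ hM0.ne']
  have h3 : 1 + q * M⁻¹ ≤ (m / M) ^ (-q) := by
    rw [Real.rpow_def_of_pos (by positivity)]
    have h4 := Real.log_le_sub_one_of_pos (show 0 < m / M by positivity)
    have h5 : m / M - 1 = -M⁻¹ := by
      field_simp
      linarith
    have h6 := Real.add_one_le_exp (Real.log (m / M) * -q)
    nlinarith
  rw [h1, h2, ← sub_div, le_div_iff₀ hq]
  have := mul_le_mul_of_nonneg_left h3 (Real.rpow_nonneg hM0.le (-q))
  linarith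

theorem sum_mul_rpow_neg_le {η : ℝ} (hη : 2 < η) (m : ℕ) :
    ∑ r ∈ Finset.range m, (r : ℝ) * (r : ℝ) ^ (-η) ≤ η / (η - 2) := by
  have hq : 0 < η - 2 := by linarith
  -- The term `r = 1` gives `1` and the others telescope to at most `1 / (η - 2)`; the total is
  -- below `η / (η - 2)`.
  have key : ∀ m : ℕ, ∑ r ∈ Finset.range (m + 2), (r : ℝ) * (r : ℝ) ^ (-η) ≤
      1 + 1 / (η - 2) - ((m + 1 : ℕ) : ℝ) ^ (-(η - 2)) / (η - 2) := by
    intro m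
    induction m with
    | zero => simp [Finset.sum_range_succ]
    | succ m ih =>
      rw [Finset.sum_range_succ]
      have := rpow_succ_le_telescope hq (m := m + 1) (by omega)
      rw [show -(η - 2 + 2) = -η by ring] at this
      linarith
  refine (Finset.sum_le_sum_of_subset_of_nonneg
    (Finset.range_subset_range.2 (show m ≤ m + 2 by omega)) fun r _ _ => by positivity).trans
    ((key m).trans ?_)
  have h1 : 0 ≤ ((m + 1 : ℕ) : ℝ) ^ (-(η - 2)) / (η - 2) := by positivity
  have h2 : η / (η - 2) = 1 + 1 / (η - 2) + 1 / (η - 2) := by field_simp; ring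
  have h3 : 0 ≤ 1 / (η - 2) := by positivity
  linarith

/-- At most `r` pairs at distance `r` straddle the cut: the left site lies in `[s - r, s)` and
determines the right one. -/
theorem sum_dist_rpow_neg_le {η : ℝ} (hη : 2 < η) (s : ℕ) :
    ∑ i ∈ leftSites n s, ∑ j ∈ rightSites n s, |(i.val : ℝ) - (j.val : ℝ)| ^ (-η) ≤
      η / (η - 2) := by
  rw [← Finset.sum_product', ← Finset.sum_fiberwise_of_maps_to
    (t := Finset.range n) (g := fun p : Fin n × Fin n => p.2.val - p.1.val)
    (fun p _ => Finset.mem_range.2 (by omega))]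
  refine le_trans (Finset.sum_le_sum fun r _ => ?_) (sum_mul_rpow_neg_le hη n)
  have hmem : ∀ p ∈ (leftSites n s ×ˢ rightSites n s).filter
      (fun p : Fin n × Fin n => p.2.val - p.1.val = r),
      p.1.val < s ∧ ¬ p.2.val < s ∧ p.2.val - p.1.val = r := by
    intro p hp
    rw [Finset.mem_filter, Finset.mem_product, mem_leftSites, mem_rightSites] at hp
    exact ⟨hp.1.1, hp.1.2, hp.2⟩
  have hcard : ((leftSites n s ×ˢ rightSites n s).filter
      (fun p : Fin n × Fin n => p.2.val - p.1.val = r)).card ≤ r := by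
    have := Finset.card_le_card_of_injOn (t := Finset.Ico (s - r) s)
      (s := (leftSites n s ×ˢ rightSites n s).filter
        (fun p : Fin n × Fin n => p.2.val - p.1.val = r)) (fun p => p.1.val) (fun p hp => by
        have := hmem p hp
        simp only [Finset.coe_Ico, Set.mem_Ico]
        omega) (fun p hp p' hp' h => by
        have h1 := hmem p hp
        have h2 := hmem p' hp'
        simp only at h
        exact Prod.ext (Fin.ext h) (Fin.ext (by omega)))
    rw [Nat.card_Ico] at this
    omega
  have hval : ∀ p ∈ (leftSites n s ×ˢ rightSites n s).filter
      (fun p : Fin n × Fin n => p.2.val - p.1.val = r),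
      |(p.1.val : ℝ) - (p.2.val : ℝ)| ^ (-η) = (r : ℝ) ^ (-η) := by
    intro p hp
    obtain ⟨h1, h2, h3⟩ := hmem p hp
    have : ((p.2.val : ℕ) : ℝ) = p.1.val + r := by
      exact_mod_cast (show p.2.val = p.1.val + r by omega)
    rw [this]
    congr 1
    simp
  rw [Finset.sum_congr rfl hval, Finset.sum_const, nsmul_eq_mul]
  exact mul_le_mul_of_nonneg_right (by exact_mod_cast hcard) (by positivity)

namespace Interaction

/-- Each boundary term contains a site on either side, so summing the decay bound over all pairs
across the cut counts it at least once. -/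
theorem PowerLawDecay.sum_norm_boundary_le {H : Interaction n d} {J₀ η : ℝ} (hη : 2 < η)
    (h : H.PowerLawDecay J₀ η) (c : Fin (n - 1)) :
    ∑ Z ∈ Finset.univ.filter (fun Z : Finset (Fin n) =>
      (∃ i ∈ Z, i.val < c.val + 1) ∧ (∃ i ∈ Z, ¬ i.val < c.val + 1)), ‖H.term Z‖ ≤
        η * J₀ / (η - 2) := by
  set s := c.val + 1 with hs
  -- A cut exists, so `n ≥ 2`, and the decay bound at sites `0` and `1`, at distance one, reads `0 ≤
  -- J₀`.
  have hJ₀ : 0 ≤ J₀ := by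
    have h0 : 0 < n := by omega
    have h1 : 1 < n := by omega
    have := (Finset.sum_nonneg fun _ _ => norm_nonneg _).trans (h ⟨0, h0⟩ ⟨1, h1⟩ (by simp))
    simpa using this
  calc _ ≤ ∑ Z, ∑ i ∈ leftSites n s, ∑ j ∈ rightSites n s,
        (if i ∈ Z ∧ j ∈ Z then ‖H.term Z‖ else 0) := by
        rw [Finset.sum_filter]
        refine Finset.sum_le_sum fun Z _ => ?_
        split_ifs with hZ
        · obtain ⟨⟨i, hi, his⟩, ⟨j, hj, hjs⟩⟩ := hZ
          refine le_trans ?_ (Finset.single_le_sum (f := fun i => ∑ j ∈ rightSites n s,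
            (if i ∈ Z ∧ j ∈ Z then ‖H.term Z‖ else 0))
            (fun i _ => Finset.sum_nonneg fun j _ => by positivity) (mem_leftSites.2 his))
          refine le_trans ?_ (Finset.single_le_sum (f := fun j =>
            (if i ∈ Z ∧ j ∈ Z then ‖H.term Z‖ else 0)) (fun j _ => by positivity)
            (mem_rightSites.2 hjs))
          rw [if_pos ⟨hi, hj⟩]
        · exact Finset.sum_nonneg fun i _ => Finset.sum_nonneg fun j _ => by positivity
    _ = ∑ i ∈ leftSites n s, ∑ j ∈ rightSites n s, ∑ Z,
        (if i ∈ Z ∧ j ∈ Z then ‖H.term Z‖ else 0) := by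
        rw [Finset.sum_comm]
        exact Finset.sum_congr rfl fun i _ => Finset.sum_comm
    _ ≤ ∑ i ∈ leftSites n s, ∑ j ∈ rightSites n s,
        J₀ * |(i.val : ℝ) - (j.val : ℝ)| ^ (-η) := by
        refine Finset.sum_le_sum fun i hi => Finset.sum_le_sum fun j hj => ?_
        rw [← Finset.sum_filter]
        refine h i j ?_
        rintro rfl
        exact mem_rightSites.1 hj (mem_leftSites.1 hi)
    _ ≤ J₀ * (η / (η - 2)) := by
        simp_rw [← Finset.mul_sum]
        exact mul_le_mul_of_nonneg_left (sum_dist_rpow_neg_le hη s) hJ₀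
    _ = η * J₀ / (η - 2) := by ring

theorem PowerLawDecay.seStrength_boundary_le {H : Interaction n d} {J₀ η : ℝ} (hη : 2 < η)
    (h : H.PowerLawDecay J₀ η) (c : Fin (n - 1)) {κ : ℝ} (hκ : 0 ≤ κ)
    (hterm : ∀ (Z : Finset (Fin n)) (p q : ℕ)
      (φ : EuclideanSpace ℂ (LCfg n d (c.val + 1) × Fin p))
      (χ : EuclideanSpace ℂ (RCfg n d (c.val + 1) × Fin q)), ‖φ‖ = 1 → ‖χ‖ = 1 →
        nuclearNorm (ancillaAmp (c.val + 1) (H.term Z) φ χ) ≤ κ * ‖H.term Z‖) :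
    seStrength (c.val + 1) (H.boundary (c.val + 1)) ≤
      ENNReal.ofReal (κ * (η * J₀ / (η - 2))) := by
  refine seStrength_le_of_forall fun p q φ χ hφ hχ => ?_
  refine (nuclearNorm_ancillaAmp_sum_le _ _ _ φ χ).trans ?_
  refine (Finset.sum_le_sum fun Z _ => hterm Z p q φ χ hφ hχ).trans ?_
  rw [← Finset.mul_sum]
  exact mul_le_mul_of_nonneg_left (h.sum_norm_boundary_le hη c) hκ

end Interaction

/-- A unit vector on a site excludes `d = 0`, so powers of `d` increase with the exponent. -/
theorem IsProductState.one_le_dim (hn : 1 ≤ n) {ψ : Chain n d} (h : IsProductState ψ) :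
    1 ≤ d := by
  obtain ⟨u, hu, -⟩ := h
  by_contra hd
  obtain rfl : d = 0 := by omega
  have h1 := hu ⟨0, hn⟩
  rw [Subsingleton.elim (u ⟨0, hn⟩) 0, norm_zero] at h1
  exact zero_ne_one h1

end TDMRG

/-! ### Assembly of the claims. -/

theorem mainTheorem9 (n d : ℕ) (hn : 1 ≤ n) (H : TDMRG.Interaction n d) (g t : ℝ)
    (hg : H.OneSiteEnergyLE g) (ht : 0 ≤ t)
    (ψ₀ : TDMRG.Chain n d) (hψ₀ : TDMRG.IsProductState ψ₀) :
    -- the algorithm can be run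
    (∀ (N D : ℕ) (rescale : Bool), Nonempty (TDMRG.Run H t N D rescale ψ₀)) ∧
    -- error bounds, for every bound `J` on the spectral entangling strengths of the cuts
    (∀ J : ℝ≥0, (∀ c : Fin (n - 1),
        TDMRG.seStrength (c.val + 1) (H.boundary (c.val + 1)) ≤ (J : ℝ≥0∞)) →
      (∀ (N D : ℕ) (rescale : Bool), 1 ≤ N → 1 ≤ D → g * n * t ≤ N →
        ∀ R : TDMRG.Run H t N D rescale ψ₀,
          (∀ m, TDMRG.IsMPS D (R.state m)) ∧
          (∀ (m : ℕ) (c : Fin (n - 1))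
            (S : TDMRG.SchmidtDecomposition (TDMRG.cutAmp (c.val + 1) (R.state (m + 1)))),
            S.sum ≤ (R.form m c).sum) ∧
          (∀ m < N, ∀ c : Fin (n - 1),
            (R.form m c).sum ≤ Real.exp (J * t + (g * n * t) ^ 2 / N)) ∧
          (∀ m < N,
            R.truncError m ≤ Real.exp (J * t + (g * n * t) ^ 2 / N) / Real.sqrt D) ∧
          ((rescale = true ∨ (g * n * t) ^ 2 / N ≤ 2) →
            ‖TDMRG.evolve H t ψ₀ - R.state N‖ ≤ (g * n * t) ^ 2 / N +
              N * Real.sqrt (2 * n / D) * Real.exp (J * t + (g * n * t) ^ 2 / N))) ∧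
      (∀ ε : ℝ, 0 < ε → ε ≤ 1 → ∃ N D : ℕ, 1 ≤ N ∧ 1 ≤ D ∧ g * n * t ≤ N ∧
        (N : ℝ) ≤ 2 * (g * n * t) ^ 2 / ε + 1 ∧
        (D : ℝ) ≤ 100 * Real.exp (2 * J * t) * n * (1 + (g * n * t) ^ 2) ^ 2 / ε ^ 4 ∧
        ∀ (rescale : Bool) (R : TDMRG.Run H t N D rescale ψ₀),
          ‖TDMRG.evolve H t ψ₀ - R.state N‖ ≤ ε)) ∧
    -- admissible values of `J` for power-law decaying interactions
    (∀ J₀ η : ℝ, 2 < η → H.PowerLawDecay J₀ η →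
      (∀ k : ℕ, H.IsKLocal k → ∀ c : Fin (n - 1),
        TDMRG.seStrength (c.val + 1) (H.boundary (c.val + 1)) ≤
          ENNReal.ofReal ((d : ℝ) ^ (k / 2) * (η * J₀ / (η - 2)))) ∧
      ((∀ Z, TDMRG.IsProductOp (H.term Z)) → ∀ c : Fin (n - 1),
        TDMRG.seStrength (c.val + 1) (H.boundary (c.val + 1)) ≤
          ENNReal.ofReal (η * J₀ / (η - 2)))) := by
  refine ⟨fun N D rescale => TDMRG.nonempty_run H t N D rescale ψ₀, fun J hJ => ⟨?_, ?_⟩, ?_⟩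
  · intro N D rescale hN hD _ R
    refine ⟨R.isMPS_state hD hn hψ₀, R.sum_le_sum_form, fun m hm c => ?_,
      fun m hm => R.truncError_le hg ht hψ₀ hJ hD hm,
      R.norm_evolve_sub_state_le hg ht hψ₀ hJ hN hD⟩
    refine (R.sum_form_le hg ht hψ₀ hJ hm c).trans (Real.exp_le_exp.2 ?_)
    have : 0 ≤ (g * n * t) ^ 2 / (N : ℝ) := by positivity
    linarith
  · intro ε hε hε1
    obtain ⟨N, D, hN, hD, hxN, hNle, hDle, hy, herr⟩ := TDMRG.exists_steps_bondDim hn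
      (x := g * n * t) (κ := J * t) (mul_nonneg J.2 ht) hε hε1
    rw [← mul_assoc] at hDle
    exact ⟨N, D, hN, hD, hxN, hNle, hDle, fun rescale R =>
      (R.norm_evolve_sub_state_le hg ht hψ₀ hJ hN hD (Or.inr hy)).trans herr⟩
  · intro J₀ η hη hdecay
    refine ⟨fun k hk c => hdecay.seStrength_boundary_le hη c (by positivity) ?_, fun hprod c => ?_⟩
    · intro Z p q φ χ hφ hχ
      rcases le_or_gt Z.card k with hZ | hZ
      · exact (H.term_supported Z).nuclearNorm_ancillaAmp_le hZ (hψ₀.one_le_dim hn) hφ hχ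
      -- Here the term is zero; the bound with `|Z|` in place of `k` has right-hand side zero, which
      -- suffices.
      · have h := (H.term_supported Z).nuclearNorm_ancillaAmp_le le_rfl (hψ₀.one_le_dim hn) hφ hχ
        rw [hk Z hZ] at h ⊢
        simpa using h
    · have := hdecay.seStrength_boundary_le hη c zero_le_one fun Z p q φ χ hφ hχ => by
        rw [one_mul]
        exact (hprod Z).nuclearNorm_ancillaAmp_le hφ hχ
      rwa [one_mul] at this
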